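/- For an entire function $F$ let $\limsup_{|z|\to\infty}|z|^{-1}\log|F(z)|$ be its exponential type. For $\Delta>0$ let $\mathcal H_{\mathrm{SO(even)},\pi\Delta}$ be the space of entire functions $F$ of exponential type at most $\pi\Delta$ with $\int_{\mathbb R}|F(x)|^2\,W(x)\,dx<\infty$, where $W(x)=1+\frac{\sin 2\pi x}{2\pi x}$, with inner product $\langle F,H\rangle=\int_{\mathbb R}F(x)\overline{H(x)}\,W(x)\,dx$. Its reproducing kernel is the function $K:\mathbb C\times\mathbb C\to\mathbb C$ such that, for each $w\in\mathbb C$, $K(w,\cdot)$ belongs to the space and $F(w)=\langle F,K(w,\cdot)\rangle$ for all $F$ in the space. Quotients $\frac{\sin(\pi c u)}{\pi u}$ (and $\frac{\sin (cu\pi)}{2\pi u}$) are understood to take their limit values at $u=0$. **Theorem.** Let $0<\Delta\le 2$. The space $\mathcal H_{\mathrm{SO(even)},\pi\Delta}$ has exactly one reproducing kernel $K$, and it is given as follows. (i) If $0<\Delta\le 1$, then for all $w,z\in\mathbb C$ $$K(w,z)=\frac{\sin\pi\Delta(z-\overline w)}{\pi(z-\overline w)}-\frac1{2+\Delta}\left(\frac{\sin\pi\Delta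 z}{\pi z}\right)\left(\frac{\sin\pi\Delta\overline w}{\pi\overline w}\right).$$ (ii) If $1<\Delta\le 2$, define the constants $$\tau:=e^{(2-\Delta)i/4}+ie^{\Delta i/4},\quad a:=e^{\Delta i/4}+ie^{(2-\Delta)i/4}-ie^{\Delta i/4}+\tfrac{2-\Delta}4\tau,\quad b:=e^{\Delta i/4}+ie^{(2-\Delta)i/4}-e^{(2-\Delta)i/4}+\tfrac{2-\Delta}4\tau$$ and the functions $$C(w):=\frac{-16\pi^2w^2-4\pi iw\,e^{2\pi iw}}{1-16\pi^2w^2},\qquad F(w):=\frac{2\cos(\pi(2-\Delta)w)-8\pi w\sin(\pi\Delta w)}{1-16\pi^2w^2},$$ $$G(w):=\frac{2\cos(\pi\Delta w)+4\pi iw\,e^{-\pi\Delta iw}-e^{\pi(2-\Delta)iw}}{1-16\pi^2w^2}-\frac{\sin(\pi(2-\Delta)w)}{2\pi w(1-16\pi^2w^2)}+\tfrac{2-\Delta}4F(w),$$ $$A(w):=\frac{\overline a\,\overline{G(\overline w)}-\overline b\,G(w)}{\overline ab-a\overline b},\quad B(w):=\frac{b\,G(w)-a\,\overline{G(\overline w)}}{\overline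 ab-a\overline b},\quad D(w):=\tfrac12\big(\tau A(w)+\overline\tau B(w)-F(w)\big).$$ Then $\overline ab-a\overline b\ne0$, and $$\begin{aligned}K(w,z)&=\frac{\overline{A(w)}\,(ie^{2\pi iz}-1)\big(e^{-\Delta(\pi iz+i/4)}-e^{-(2-\Delta)(\pi iz+i/4)}\big)}{2\pi iz+i/2}\\&\quad+\frac{\overline{B(w)}\,(-ie^{2\pi iz}-1)\big(e^{-\Delta(\pi iz-i/4)}-e^{-(2-\Delta)(\pi iz-i/4)}\big)}{2\pi iz-i/2}\\&\quad+\frac{C(\overline w)\big(e^{\pi\Delta i(z-\overline w)}-e^{\pi(2-\Delta)i(z-\overline w)}\big)+\overline{C(w)}\big(-e^{-\pi\Delta i(z-\overline w)}+e^{-\pi(2-\Delta)i(z-\overline w)}\big)}{2\pi i(z-\overline w)}\\&\quad+\frac{\overline{D(w)}\sin(\pi(2-\Delta)z)}{\pi z}+\frac{\sin(\pi(2-\Delta)(z-\overline w))}{\pi(z-\overline w)}\end{aligned}$$ for all $w,z\in\mathbb C$ with $w\ne\pm\frac1{4\pi}$, $z\ne\pm\frac1{4\pi}$, $z\ne\overline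 w$. For each $z$ the function $w\mapsto K(\overline w,z)$ is entire, and at every excluded point $(w_0,z_0)$ the value $K(w_0,z_0)$ is the limit of the right-hand side as $(w,z)\to(w_0,z_0)$ through non-excluded points. -/

import Mathlib

open Complex Filter Topology MeasureTheory
open scoped ComplexConjugate Real

noncomputable section

namespace SOEven

/-- The exponential type `limsup_{|z| → ∞} |z|⁻¹ log |F z|` of a function `F : ℂ → ℂ`,
in `[-∞, ∞]`, with `log 0 = -∞`. -/
def expType (F : ℂ → ℂ) : EReal :=
  limsup (fun z : ℂ => ((‖z‖⁻¹ : ℝ) : EReal) * ENNReal.log ‖F z‖ₑ) (cocompact ℂ)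

/-- The density `W(x) = 1 + sin(2πx) / (2πx)` of the symmetry type SO(even). -/
def W (x : ℝ) : ℝ := 1 + Real.sinc (2 * π * x)

/-- The entire functions of exponential type at most `πΔ` with `∫ |F(x)|² W(x) dx < ∞`. -/
def space (Δ : ℝ) : Set (ℂ → ℂ) :=
  {F | Differentiable ℂ F ∧ expType F ≤ ((π * Δ : ℝ) : EReal) ∧
    Integrable (fun x : ℝ => ‖F x‖ ^ 2 * W x)}

/-- The inner product `⟨F, H⟩ = ∫ F(x) conj(H(x)) W(x) dx` of the space
(linear in the first variable). -/
def innerW (F H : ℂ → ℂ) : ℂ := ∫ x : ℝ, F x * conj (H x) * (W x : ℂ)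

/-- `K` is a reproducing kernel of the space: every `K(w, ·)` lies in it, and
`F(w) = ⟨F, K(w, ·)⟩` for each `F` in it. -/
def IsReproducingKernel (Δ : ℝ) (K : ℂ → ℂ → ℂ) : Prop :=
  ∀ w : ℂ, K w ∈ space Δ ∧ ∀ F ∈ space Δ, F w = innerW F (K w)

/-- The entire function `u ↦ sin(πcu) / (πu)`, with its value `c` at `u = 0`. -/
def sinQuot (c : ℝ) (u : ℂ) : ℂ := if u = 0 then (c : ℂ) else sin (π * c * u) / (π * u)

variable (Δ : ℝ)

/-- The constant `τ`. -/
def τ : ℂ := exp ((2 - Δ) * I / 4) + I * exp (Δ * I / 4)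

/-- The constant `a`. -/
def a : ℂ :=
  exp (Δ * I / 4) + I * exp ((2 - Δ) * I / 4) - I * exp (Δ * I / 4) + ((2 - Δ) / 4) * τ Δ

/-- The constant `b`. -/
def b : ℂ :=
  exp (Δ * I / 4) + I * exp ((2 - Δ) * I / 4) - exp ((2 - Δ) * I / 4) + ((2 - Δ) / 4) * τ Δ

/-- The function `C`; it does not depend on `Δ`. -/
def C (w : ℂ) : ℂ :=
  (-16 * π ^ 2 * w ^ 2 - 4 * π * I * w * exp (2 * π * I * w)) / (1 - 16 * π ^ 2 * w ^ 2)

/-- The function `F`. -/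
def F (w : ℂ) : ℂ :=
  (2 * cos (π * (2 - Δ) * w) - 8 * π * w * sin (π * Δ * w)) / (1 - 16 * π ^ 2 * w ^ 2)

/-- The function `G`; the quotient `sin(π(2-Δ)w) / (2πw)` takes its limit value at `w = 0`. -/
def G (w : ℂ) : ℂ :=
  (2 * cos (π * Δ * w) + 4 * π * I * w * exp (-π * Δ * I * w) - exp (π * (2 - Δ) * I * w))
      / (1 - 16 * π ^ 2 * w ^ 2)
    - sinQuot (2 - Δ) w / (2 * (1 - 16 * π ^ 2 * w ^ 2))
    + ((2 - Δ) / 4) * F Δ w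

/-- The common denominator of `A` and `B`. -/
def den : ℂ := conj (a Δ) * b Δ - a Δ * conj (b Δ)

/-- The function `A`. -/
def A (w : ℂ) : ℂ := (conj (a Δ) * conj (G Δ (conj w)) - conj (b Δ) * G Δ w) / den Δ

/-- The function `B`. -/
def B (w : ℂ) : ℂ := (b Δ * G Δ w - a Δ * conj (G Δ (conj w))) / den Δ

/-- The function `D`. -/
def D (w : ℂ) : ℂ := (1 / 2) * (τ Δ * A Δ w + conj (τ Δ) * B Δ w - F Δ w)

/-- The explicit kernel for `0 < Δ ≤ 1`. -/
def kernelSmall (w z : ℂ) : ℂ :=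
  sinQuot Δ (z - conj w) - 1 / (2 + Δ) * sinQuot Δ z * sinQuot Δ (conj w)

/-- The explicit expression for `1 < Δ ≤ 2`, meaningful as it stands on `regular`. -/
def kernelLarge (w z : ℂ) : ℂ :=
  conj (A Δ w) * (I * exp (2 * π * I * z) - 1) *
      (exp (-Δ * (π * I * z + I / 4)) - exp (-(2 - Δ) * (π * I * z + I / 4)))
      / (2 * π * I * z + I / 2)
    + conj (B Δ w) * (-I * exp (2 * π * I * z) - 1) *
      (exp (-Δ * (π * I * z - I / 4)) - exp (-(2 - Δ) * (π * I * z - I / 4)))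
      / (2 * π * I * z - I / 2)
    + (C (conj w) * (exp (π * Δ * I * (z - conj w)) - exp (π * (2 - Δ) * I * (z - conj w)))
        + conj (C w) * (-exp (-π * Δ * I * (z - conj w)) + exp (-π * (2 - Δ) * I * (z - conj w))))
      / (2 * π * I * (z - conj w))
    + conj (D Δ w) * sinQuot (2 - Δ) z + sinQuot (2 - Δ) (z - conj w)

/-- The dense open set of all `(w, z)` at which none of the denominators that depend on `w` and `z`
in `kernelLarge` vanishes. -/
def regular : Set (ℂ × ℂ) :=
  {p | 1 - 16 * π ^ 2 * p.1 ^ 2 ≠ 0 ∧ 2 * π * I * p.2 + I / 2 ≠ 0 ∧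
    2 * π * I * p.2 - I / 2 ≠ 0 ∧ p.2 ≠ conj p.1}

end SOEven

end

noncomputable section

/-! The weight `W` has Fourier transform δ + ½·1_[-1,1] and satisfies 1/2 ≤ W ≤ 2, so the space is
as a set the Paley–Wiener space of spectrum [-L, L], where L = Δ/2. Let k be the transform of a
function h supported in (-L, L], and φ the Fourier transform of f. Since convolution with 1_[-1,1]
is self-adjoint, ⟨f, k⟩ = ∫ φ · conj(h + ½ 1_[-1,1] * h). Hence k reproduces at w as soon as h(s) +
½∫_{s-1}^{s+1} h = exp(-2πi w̄ s) on (-L, L] (`reproduces_of_integral_equation`). Only this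
sufficiency is needed, since at most one function reproduces at w (`reproducing_unique`): it is
enough to write a solution down and verify it. The Fourier argument is run for f with quadratic
decay on ℝ; `repr_of_bounded` and `repr_of_square_integrable` carry it to the whole space.

For Δ ≤ 1 the window [s-1, s+1] always contains the support, the integral is constant in s, and h is
an exponential plus a constant. For 1 < Δ ≤ 2 this is so only on the middle interval (L-1, 1-L]. On
the outer intervals, which differ by a translation by 1, differentiation gives a coupled system
h_l'(s) = -½h_r(s+1) + …, h_r'(s) = ½h_l(s-1) + …, so that h'' = -h/4 up to the forcing term. This
produces the exponentials e^{±it/2}, with free coefficients α, β, and multiples c, c' of exp(-2πi w̄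
t). Three junction conditions fix α, β and the middle constant δ; they are the linear system solved
by `A`, `B`, `D`, whose determinant `den` is computed in `den_eq`.

The forcing exponential is resonant with e^{±it/2} at w = ±1/(4π), where the coefficients
degenerate. There the kernel is obtained as the mean of the kernels over a circle about w, because
f(w) is the mean of f over it (`exists_reproducesAt`). Hermitian symmetry makes K entire in w̄. The
maximum principle in w̄ and Cauchy's estimate in z then give joint continuity
(`IsReproducingKernel.tendsto_nhds`), hence the limits at the excluded points. -/

namespace SOEven

/-! ### Exponential type as a family of growth bounds -/

/-- `f` has exponential type at most `σ`, expressed by norm bounds. -/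
def HasGrowth (σ : ℝ) (f : ℂ → ℂ) : Prop :=
  ∀ η : ℝ, 0 < η → ∃ M : ℝ, 0 ≤ M ∧ ∀ z, ‖f z‖ ≤ M * Real.exp ((σ + η) * ‖z‖)

lemma HasGrowth.of_bound {σ M : ℝ} {f : ℂ → ℂ} (h : ∀ z, ‖f z‖ ≤ M * Real.exp (σ * ‖z‖)) :
    HasGrowth σ f := by
  intro η hη
  have hM : 0 ≤ M := by
    have := (norm_nonneg _).trans (h 0)
    simpa using this
  refine ⟨M, hM, fun z => (h z).trans ?_⟩
  gcongr
  linarith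

lemma HasGrowth.sub {σ : ℝ} {f g : ℂ → ℂ} (hf : HasGrowth σ f) (hg : HasGrowth σ g) :
    HasGrowth σ (fun z => f z - g z) := by
  intro η hη
  obtain ⟨M, hM, h⟩ := hf η hη
  obtain ⟨N, hN, h'⟩ := hg η hη
  refine ⟨M + N, by positivity, fun z => (norm_sub_le _ _).trans ?_⟩
  rw [add_mul]
  exact add_le_add (h z) (h' z)

/-- For `y = 0` the logarithm is `⊥`, and multiplication by the positive number ‖z‖⁻¹ keeps it `⊥`.
At `z = 0` the inverse would take its default value 0. -/
lemma norm_log_le_iff {z : ℂ} (hz : z ≠ 0) (y : ℂ) (r : ℝ) :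
    ((‖z‖⁻¹ : ℝ) : EReal) * ENNReal.log ‖y‖ₑ ≤ (r : EReal) ↔ ‖y‖ ≤ Real.exp (r * ‖z‖) := by
  have hz' : 0 < ‖z‖ := norm_pos_iff.2 hz
  by_cases hy : y = 0
  · subst hy
    simp only [enorm_zero, ENNReal.log_zero, norm_zero]
    rw [EReal.coe_mul_bot_of_pos (by positivity)]
    simp [Real.exp_nonneg]
  · have hy' : 0 < ‖y‖ := norm_pos_iff.2 hy
    rw [← ofReal_norm, ENNReal.log_ofReal_of_pos hy', ← EReal.coe_mul, EReal.coe_le_coe_iff,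
      inv_mul_le_iff₀ hz', Real.log_le_iff_le_exp hy', mul_comm]

lemma expType_le_of_hasGrowth {σ : ℝ} {f : ℂ → ℂ} (h : HasGrowth σ f) :
    expType f ≤ (σ : EReal) := by
  refine EReal.le_of_forall_lt_iff_le.1 fun r hr => ?_
  have hr' : σ < r := by exact_mod_cast hr
  -- Half of the slack `r - σ` is spent on the growth bound; the other half absorbs the constant `M`
  -- for large ‖z‖.
  obtain ⟨M, hM, hb⟩ := h ((r - σ) / 2) (by linarith)
  refine limsup_le_of_le (by isBoundedDefault) ?_
  have h1 : Tendsto (fun z : ℂ => Real.exp ((r - σ) / 2 * ‖z‖)) (cocompact ℂ) atTop :=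
    Real.tendsto_exp_atTop.comp
      ((tendsto_norm_cocompact_atTop).const_mul_atTop (by linarith))
  filter_upwards [h1.eventually_ge_atTop M, tendsto_norm_cocompact_atTop.eventually_gt_atTop 0]
    with z hz hz0
  rw [norm_log_le_iff (norm_pos_iff.1 hz0)]
  refine (hb z).trans ?_
  calc M * Real.exp ((σ + (r - σ) / 2) * ‖z‖)
      ≤ Real.exp ((r - σ) / 2 * ‖z‖) * Real.exp ((σ + (r - σ) / 2) * ‖z‖) := by gcongr
    _ = Real.exp (r * ‖z‖) := by rw [← Real.exp_add]; ring_nf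

/-- The limsup gives the bound off a compact set. On that set `f` is bounded by continuity, and `0 ≤
σ` keeps the exponential at least 1. -/
lemma hasGrowth_of_expType_le {σ : ℝ} (hσ : 0 ≤ σ) {f : ℂ → ℂ} (hf : Continuous f)
    (h : expType f ≤ (σ : EReal)) : HasGrowth σ f := by
  intro η hη
  have h1 : expType f < ((σ + η : ℝ) : EReal) :=
    h.trans_lt (by exact_mod_cast (by linarith : σ < σ + η))
  have h2 := eventually_lt_of_limsup_lt h1 (by isBoundedDefault)
  have h3 : ∀ᶠ z in cocompact ℂ, ‖f z‖ ≤ Real.exp ((σ + η) * ‖z‖) := by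
    filter_upwards [h2, tendsto_norm_cocompact_atTop.eventually_gt_atTop 0] with z hz hz0
    exact (norm_log_le_iff (norm_pos_iff.1 hz0) _ _).1 hz.le
  obtain ⟨K, hK, hK'⟩ := mem_cocompact.1 h3
  obtain ⟨M, hM⟩ := hK.exists_bound_of_continuousOn hf.continuousOn
  refine ⟨max 1 M, by positivity, fun z => ?_⟩
  by_cases hz : z ∈ K
  · calc ‖f z‖ ≤ max 1 M * 1 := by rw [mul_one]; exact (hM z hz).trans (le_max_right _ _)
      _ ≤ _ := by
        gcongr
        exact Real.one_le_exp (by positivity)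
  · calc ‖f z‖ ≤ 1 * Real.exp ((σ + η) * ‖z‖) := by rw [one_mul]; exact hK' hz
      _ ≤ _ := by gcongr; exact le_max_left _ _

/-! ### The weight and the space -/

lemma continuous_W : Continuous W := by
  unfold W
  exact continuous_const.add (Real.continuous_sinc.comp (by fun_prop))

lemma W_le_two (x : ℝ) : W x ≤ 2 := by
  have := Real.sinc_le_one (2 * π * x)
  unfold W; linarith

/-- On [0, π] sinc is nonnegative, and beyond π it is at least -1/π. The crude constant 1/2 keeps
`W` away from 0. -/
lemma neg_half_le_sinc (x : ℝ) : -(1 / 2) ≤ Real.sinc x := by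
  wlog hx : 0 ≤ x generalizing x
  · have := this (-x) (by linarith)
    rwa [Real.sinc_neg] at this
  rcases hx.eq_or_lt with rfl | hx
  · simp; norm_num
  rw [Real.sinc_of_ne_zero hx.ne']
  rcases le_or_gt x π with h | h
  · have := div_nonneg (Real.sin_nonneg_of_nonneg_of_le_pi hx.le h) hx.le
    linarith
  · rw [le_div_iff₀ hx]
    have := Real.neg_one_le_sin x
    have := Real.pi_gt_three
    linarith

lemma half_le_W (x : ℝ) : 1 / 2 ≤ W x := by
  have := neg_half_le_sinc (2 * π * x)
  unfold W; linarith

lemma W_pos (x : ℝ) : 0 < W x := by linarith [half_le_W x]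

lemma integrable_mul_W_iff {f : ℂ → ℂ} (hf : Continuous f) :
    Integrable (fun x : ℝ => ‖f x‖ ^ 2 * W x) ↔ Integrable (fun x : ℝ => ‖f x‖ ^ 2) := by
  have hc := continuous_W
  constructor <;> intro h
  · refine (h.const_mul 2).mono' (by fun_prop) (ae_of_all _ fun x => ?_)
    have := half_le_W x
    rw [Real.norm_of_nonneg (by positivity)]
    nlinarith [sq_nonneg ‖f x‖]
  · refine (h.const_mul 2).mono' (by fun_prop) (ae_of_all _ fun x => ?_)
    have := W_le_two x
    have := W_pos x
    rw [Real.norm_of_nonneg (by positivity)]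
    nlinarith [sq_nonneg ‖f x‖]

/-- Because 1/2 ≤ W ≤ 2, the weight does not affect membership: this is the ordinary Paley–Wiener
space. -/
lemma mem_space_iff {Δ : ℝ} (hΔ : 0 < Δ) {f : ℂ → ℂ} :
    f ∈ space Δ ↔ Differentiable ℂ f ∧ HasGrowth (π * Δ) f ∧
      Integrable (fun x : ℝ => ‖f x‖ ^ 2) := by
  constructor
  · rintro ⟨h1, h2, h3⟩
    exact ⟨h1, hasGrowth_of_expType_le (by positivity) h1.continuous h2,
      (integrable_mul_W_iff h1.continuous).1 h3⟩
  · rintro ⟨h1, h2, h3⟩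
    exact ⟨h1, expType_le_of_hasGrowth h2, (integrable_mul_W_iff h1.continuous).2 h3⟩

lemma sub_mem_space {Δ : ℝ} (hΔ : 0 < Δ) {f g : ℂ → ℂ} (hf : f ∈ space Δ) (hg : g ∈ space Δ) :
    (fun z => f z - g z) ∈ space Δ := by
  rw [mem_space_iff hΔ] at *
  obtain ⟨f1, f2, f3⟩ := hf
  obtain ⟨g1, g2, g3⟩ := hg
  refine ⟨f1.sub g1, f2.sub g2, ?_⟩
  have := f1.continuous
  have := g1.continuous
  refine ((f3.const_mul 2).add (g3.const_mul 2)).mono' (by fun_prop) (ae_of_all _ fun x => ?_)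
  rw [Real.norm_of_nonneg (by positivity)]
  have := norm_sub_le (f x) (g x)
  simp only [Pi.add_apply]
  nlinarith [sq_nonneg (‖f x‖ - ‖g x‖), norm_nonneg (f x - g x)]

lemma integrable_inner {f g : ℂ → ℂ} (hf : Continuous f) (hg : Continuous g)
    (hf2 : Integrable (fun x : ℝ => ‖f x‖ ^ 2)) (hg2 : Integrable (fun x : ℝ => ‖g x‖ ^ 2)) :
    Integrable (fun x : ℝ => f x * conj (g x) * (W x : ℂ)) := by
  have hc := continuous_W
  refine (hf2.add hg2).mono' ?_ (ae_of_all _ fun x => ?_)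
  · have : Continuous fun x : ℝ => f x * conj (g x) * (W x : ℂ) := by
      have := Complex.continuous_conj
      fun_prop
    exact this.aestronglyMeasurable
  · rw [norm_mul, norm_mul, RCLike.norm_conj, Complex.norm_real, Real.norm_of_nonneg (W_pos x).le]
    have := W_le_two x
    have := W_pos x
    simp only [Pi.add_apply]
    nlinarith [sq_nonneg (‖f x‖ - ‖g x‖), mul_nonneg (norm_nonneg (f x)) (norm_nonneg (g x))]

/-! ### Uniqueness of the kernel -/

lemma eq_of_eq_on_real {f g : ℂ → ℂ} (hf : Differentiable ℂ f) (hg : Differentiable ℂ g)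
    (h : ∀ x : ℝ, f x = g x) : f = g := by
  have hfa : AnalyticOnNhd ℂ f Set.univ := fun z _ => hf.analyticAt z
  have hga : AnalyticOnNhd ℂ g Set.univ := fun z _ => hg.analyticAt z
  refine hfa.eq_of_frequently_eq hga (z₀ := 0) ?_
  have ht : Tendsto (fun x : ℝ => (x : ℂ)) (𝓝[≠] 0) (𝓝[≠] 0) := by
    refine tendsto_nhdsWithin_iff.2 ⟨?_, ?_⟩
    · exact (Complex.continuous_ofReal.tendsto' 0 0 (by simp)).mono_left nhdsWithin_le_nhds
    · filter_upwards [self_mem_nhdsWithin] with x hx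
      simpa using hx
  exact ht.frequently (Eventually.frequently (Eventually.of_forall h))

/-- The difference `k - l` lies in the space and is orthogonal to itself. As `W` is positive and
everything is continuous, it vanishes on ℝ, hence identically. -/
lemma reproducing_unique {Δ : ℝ} (hΔ : 0 < Δ) {w : ℂ} {k l : ℂ → ℂ}
    (hk : k ∈ space Δ) (hl : l ∈ space Δ)
    (hk' : ∀ f ∈ space Δ, f w = innerW f k) (hl' : ∀ f ∈ space Δ, f w = innerW f l) : k = l := by
  have hd := sub_mem_space hΔ hk hl
  obtain ⟨d1, -, d3⟩ := (mem_space_iff hΔ).1 hd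
  obtain ⟨k1, -, k3⟩ := (mem_space_iff hΔ).1 hk
  obtain ⟨l1, -, l3⟩ := (mem_space_iff hΔ).1 hl
  have h0 : innerW (fun z => k z - l z) (fun z => k z - l z) = 0 := by
    have h1 := (hk' _ hd).symm.trans (hl' _ hd)
    rw [← sub_eq_zero] at h1
    rw [← h1]
    unfold innerW
    rw [← integral_sub (integrable_inner d1.continuous k1.continuous d3 k3)
      (integrable_inner d1.continuous l1.continuous d3 l3)]
    congr 1
    ext x
    rw [map_sub]; ring
  have h2 : ∫ x : ℝ, ‖k x - l x‖ ^ 2 * W x = 0 := by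
    have : (fun x : ℝ => (k x - l x) * conj (k x - l x) * (W x : ℂ))
        = fun x : ℝ => ((‖k x - l x‖ ^ 2 * W x : ℝ) : ℂ) := by
      ext x
      rw [Complex.mul_conj, Complex.normSq_eq_norm_sq]; push_cast; ring
    unfold innerW at h0
    rw [this, integral_complex_ofReal] at h0
    exact_mod_cast h0
  have hc := continuous_W
  have hck := k1.continuous
  have hcl := l1.continuous
  have h3 := (integral_eq_zero_iff_of_nonneg
    (fun x => mul_nonneg (sq_nonneg _) (W_pos x).le)
    ((integrable_mul_W_iff d1.continuous).2 d3)).1 h2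
  have h4 : (fun x : ℝ => ‖k x - l x‖ ^ 2 * W x) = fun _ => 0 :=
    Continuous.ae_eq_iff_eq volume (by fun_prop) continuous_const |>.1 h3
  refine eq_of_eq_on_real k1 l1 fun x => ?_
  have h5 := congrFun h4 x
  simp only [mul_eq_zero, (W_pos x).ne', or_false] at h5
  exact sub_eq_zero.1 (norm_eq_zero.1 (by simpa using h5))

/-! ### Paley–Wiener theorem for functions with quadratic decay -/

/-- An entire function of exponential type less than `2πξ` that decays quadratically on the
real line is bounded by `M / |z + i|²` on the closed upper half plane after twisting by
`exp (2πiξz)`. -/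
lemma norm_twist_le {σ M ξ : ℝ} {f : ℂ → ℂ} (hf : Differentiable ℂ f) (hg : HasGrowth σ f)
    (hM : ∀ x : ℝ, ‖f x‖ * (1 + x ^ 2) ≤ M) (hξ : σ < 2 * π * ξ) {z : ℂ}
    (hz : 0 ≤ z.im) :
    ‖f z * exp (2 * π * I * ξ * z) * (z + I) ^ 2‖ ≤ M := by
  set g : ℂ → ℂ := fun z => f z * exp (2 * π * I * ξ * z) * (z + I) ^ 2 with hgdef
  have hgd : Differentiable ℂ g := by fun_prop
  -- The rotation carries the right half plane to the upper one: the imaginary axis goes to ℝ, where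
  -- `hM` bounds `g`, and the positive real axis to the positive imaginary axis.
  set u : ℂ → ℂ := fun z => g (I * z) with hu
  have hud : Differentiable ℂ u := hgd.comp (by fun_prop)
  -- With half of the gap as `η`, one has σ + η = 2πξ - η. Along the positive imaginary axis a decay
  -- e^{-η‖z‖} remains, which balances the factor e^{η(‖z‖+1)} that dominates |z + i|².
  set η : ℝ := (2 * π * ξ - σ) / 2 with hη
  have hη0 : 0 < η := by rw [hη]; linarith
  obtain ⟨N, hN, hb⟩ := hg η hη0
  have hexp : ∀ z : ℂ, ‖exp (2 * π * I * ξ * z)‖ = Real.exp (-(2 * π * ξ * z.im)) := by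
    intro z
    rw [Complex.norm_exp]
    congr 1
    simp
  have hsq : ∀ r : ℝ, 0 ≤ r → (r + 1) ^ 2 ≤ 2 / η ^ 2 * Real.exp (η * (r + 1)) := by
    intro r hr
    have h := Real.quadratic_le_exp_of_nonneg (x := η * (r + 1)) (by positivity)
    rw [div_mul_eq_mul_div, le_div_iff₀ (by positivity)]
    have : 0 ≤ η * (r + 1) := by positivity
    nlinarith
  have hnI : ∀ z : ℂ, ‖(z + I) ^ 2‖ ≤ (‖z‖ + 1) ^ 2 := by
    intro z
    rw [norm_pow]
    gcongr
    exact (norm_add_le _ _).trans (by simp)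
  have key : ∀ z : ℂ, ‖g z‖ ≤ N * Real.exp ((σ + η) * ‖z‖) * Real.exp (-(2 * π * ξ * z.im)) *
      (2 / η ^ 2 * Real.exp (η * (‖z‖ + 1))) := by
    intro z
    simp only [hgdef]
    rw [norm_mul, norm_mul, hexp]
    gcongr
    · exact hb z
    · exact (hnI z).trans (hsq _ (norm_nonneg _))
  have h1 : ‖u (-I * z)‖ ≤ M := by
    refine PhragmenLindelof.right_half_plane_of_bounded_on_real hud.diffContOnCl
      ⟨1, by norm_num, σ + η + |2 * π * ξ| + η, ?_⟩ ?_ ?_ ?_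
    · refine Asymptotics.IsBigO.of_bound (N * (2 / η ^ 2) * Real.exp η) ?_
      refine Eventually.of_forall fun z => ?_
      rw [Real.norm_of_nonneg (Real.exp_nonneg _), Real.rpow_one]
      refine (key (I * z)).trans ?_
      have e1 : ‖I * z‖ = ‖z‖ := by simp
      rw [e1]
      have h2 : -(2 * π * ξ * (I * z).im) ≤ |2 * π * ξ| * ‖z‖ := by
        calc -(2 * π * ξ * (I * z).im) ≤ |2 * π * ξ * (I * z).im| := neg_le_abs _
          _ = |2 * π * ξ| * |(I * z).im| := abs_mul _ _
          _ ≤ _ := by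
            gcongr
            exact (Complex.abs_im_le_norm _).trans_eq e1
      calc _ ≤ N * Real.exp ((σ + η) * ‖z‖) * Real.exp (|2 * π * ξ| * ‖z‖) *
            (2 / η ^ 2 * Real.exp (η * (‖z‖ + 1))) := by gcongr
        _ = N * (2 / η ^ 2) * Real.exp η * Real.exp ((σ + η + |2 * π * ξ| + η) * ‖z‖) := by
          rw [show (σ + η + |2 * π * ξ| + η) * ‖z‖ =
            (σ + η) * ‖z‖ + |2 * π * ξ| * ‖z‖ + η * ‖z‖ by ring,
            Real.exp_add, Real.exp_add, mul_add, Real.exp_add, mul_one]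
          ring
    · refine ⟨N * (2 / η ^ 2) * Real.exp η, ?_⟩
      simp only [eventually_map]
      filter_upwards [eventually_ge_atTop 0] with x hx
      refine (key (I * x)).trans_eq ?_
      have e1 : ‖I * (x : ℂ)‖ = x := by simp [abs_of_nonneg hx]
      have e2 : (I * (x : ℂ)).im = x := by simp
      rw [e1, e2]
      rw [show (σ + η) * x = 2 * π * ξ * x - η * x by rw [hη]; ring, Real.exp_sub, mul_add,
        Real.exp_add, Real.exp_neg, mul_one]
      have := Real.exp_ne_zero (2 * π * ξ * x)
      have := Real.exp_ne_zero (η * x)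
      field_simp
    · intro x
      have e1 : I * ((x : ℂ) * I) = ((-x : ℝ) : ℂ) := by
        push_cast; linear_combination (x : ℂ) * I_mul_I
      have h3 := hM (-x)
      simp only [hu, e1, hgdef]
      rw [norm_mul, norm_mul, hexp]
      have e2 : ‖(((-x : ℝ) : ℂ) + I) ^ 2‖ = 1 + (-x) ^ 2 := by
        rw [norm_pow, ← Complex.normSq_eq_norm_sq, Complex.normSq_apply]
        simp; ring
      rw [e2]
      simpa using h3
    · simpa using hz
  have e3 : I * (-I * z) = z := by linear_combination (-z) * I_mul_I
  simpa only [hu, e3] using h1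

/-- Cauchy's theorem on the rectangle [-R, R] × [0, R]: on the three upper sides, of total length
4R, `g` is at most M/R², so the integral over the base is at most 4M/R. -/
lemma integral_eq_zero_of_decay_upper {g : ℂ → ℂ} {M : ℝ} (hg : Differentiable ℂ g)
    (hM : ∀ z : ℂ, 0 ≤ z.im → ‖g z * (z + I) ^ 2‖ ≤ M) : ∫ x : ℝ, g x = 0 := by
  have hM0 : 0 ≤ M := (norm_nonneg _).trans (hM 0 le_rfl)
  have hint : Integrable (fun x : ℝ => g x) := by
    refine (integrable_inv_one_add_sq.const_mul M).mono' ?_ (ae_of_all _ fun x => ?_)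
    · exact (hg.continuous.comp continuous_ofReal).aestronglyMeasurable
    · have h := hM x (by simp)
      rw [norm_mul, norm_pow, ← Complex.normSq_eq_norm_sq, Complex.normSq_apply] at h
      simp at h
      rw [← div_eq_mul_inv, le_div_iff₀ (by positivity)]
      nlinarith
  have hlim : Tendsto (fun R : ℝ => ∫ x in (-R)..R, g x) atTop (𝓝 (∫ x : ℝ, g x)) :=
    intervalIntegral_tendsto_integral hint tendsto_neg_atTop_atBot tendsto_id
  have hbd : ∀ z : ℂ, 0 ≤ z.im → ∀ R : ℝ, 0 < R → R ≤ ‖z + I‖ → ‖g z‖ ≤ M / R ^ 2 := by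
    intro z hz R hR hzR
    have h := hM z hz
    rw [norm_mul, norm_pow] at h
    rw [le_div_iff₀ (by positivity)]
    refine le_trans ?_ h
    gcongr
  have hlim0 : Tendsto (fun R : ℝ => ∫ x in (-R)..R, g x) atTop (𝓝 0) := by
    refine squeeze_zero_norm' (a := fun R : ℝ => 4 * M / R) ?_ ?_
    · filter_upwards [eventually_gt_atTop 0] with R hR
      have hrect := Complex.integral_boundary_rect_eq_zero_of_differentiableOn g
        (((-R : ℝ) : ℂ)) ((R : ℂ) + R * I) hg.differentiableOn
      simp only [ofReal_re, add_re, mul_re, I_re, mul_zero, ofReal_im, I_im, mul_one, sub_self,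
        add_zero, add_im, mul_im, zero_add] at hrect
      have hb1 : ‖∫ x in (-R)..R, g (x + R * I)‖ ≤ M / R ^ 2 * |R - -R| := by
        refine intervalIntegral.norm_integral_le_of_norm_le_const fun x _ => ?_
        refine hbd _ (by simpa using hR.le) R hR ?_
        have := Complex.abs_im_le_norm ((x : ℂ) + R * I + I)
        refine le_trans ?_ this
        simp
        rw [abs_of_pos (by linarith)]
        linarith
      have hb2 : ‖∫ y in (0 : ℝ)..R, g (R + y * I)‖ ≤ M / R ^ 2 * |R - 0| := by
        refine intervalIntegral.norm_integral_le_of_norm_le_const fun y hy => ?_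
        rw [Set.uIoc_of_le hR.le] at hy
        refine hbd _ (by simpa using hy.1.le) R hR ?_
        have := Complex.abs_re_le_norm ((R : ℂ) + y * I + I)
        refine le_trans ?_ this
        simp
        exact le_abs_self R
      have hb3 : ‖∫ y in (0 : ℝ)..R, g (((-R : ℝ) : ℂ) + y * I)‖ ≤ M / R ^ 2 * |R - 0| := by
        refine intervalIntegral.norm_integral_le_of_norm_le_const fun y hy => ?_
        rw [Set.uIoc_of_le hR.le] at hy
        refine hbd _ (by simpa using hy.1.le) R hR ?_
        have := Complex.abs_re_le_norm ((((-R : ℝ) : ℂ)) + y * I + I)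
        refine le_trans ?_ this
        simp
        exact le_abs_self R
      have hmain : ∫ x in (-R)..R, g x = (∫ x in (-R)..R, g (x + R * I))
          - I • (∫ y in (0 : ℝ)..R, g (R + y * I))
          + I • ∫ y in (0 : ℝ)..R, g (((-R : ℝ) : ℂ) + y * I) := by
        simp only [ofReal_zero, zero_mul, add_zero] at hrect
        linear_combination hrect
      rw [hmain]
      refine (norm_add_le _ _).trans ?_
      refine (add_le_add_left (norm_sub_le _ _) _).trans ?_
      rw [norm_smul, norm_smul, norm_I, one_mul, one_mul]
      calc _ ≤ M / R ^ 2 * |R - -R| + M / R ^ 2 * |R - 0| + M / R ^ 2 * |R - 0| := by gcongr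
        _ = 4 * M / R := by
          rw [sub_zero, sub_neg_eq_add, abs_of_pos (by linarith), abs_of_pos hR]
          field_simp; ring
    · exact tendsto_const_nhds.div_atTop tendsto_id
  exact tendsto_nhds_unique hlim hlim0

/-- This confines the spectrum to the exponential type. For positive frequency the contour moves up;
for negative frequency z ↦ -z reduces to that case. -/
lemma integral_twist_eq_zero {σ M ξ : ℝ} {f : ℂ → ℂ} (hf : Differentiable ℂ f)
    (hg : HasGrowth σ f) (hM : ∀ x : ℝ, ‖f x‖ * (1 + x ^ 2) ≤ M)
    (hξ : σ < 2 * π * |ξ|) : ∫ x : ℝ, f x * exp (2 * π * I * ξ * x) = 0 := by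
  rcases le_total 0 ξ with h | h
  · rw [abs_of_nonneg h] at hξ
    exact integral_eq_zero_of_decay_upper (g := fun z => f z * exp (2 * π * I * ξ * z))
      (by fun_prop) fun z hz => norm_twist_le hf hg hM hξ hz
  · rw [abs_of_nonpos h] at hξ
    have hgn : HasGrowth σ fun z => f (-z) := by
      intro η hη
      obtain ⟨N, hN, hb⟩ := hg η hη
      exact ⟨N, hN, fun z => by simpa using hb (-z)⟩
    have := integral_eq_zero_of_decay_upper
      (g := fun z => f (-z) * exp (2 * π * I * (-ξ : ℝ) * z)) (M := M)
      (by
        have : Differentiable ℂ fun z => f (-z) := hf.comp (by fun_prop)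
        fun_prop) fun z hz => norm_twist_le (f := fun z => f (-z))
        (hf.comp (by fun_prop)) hgn (fun x => by simpa using hM (-x)) hξ hz
    rw [← integral_neg_eq_self] at this
    rw [← this]
    congr 1; ext x
    push_cast
    simp

/-- An integral over a compact interval of functions depending holomorphically on a parameter is
holomorphic in the parameter. -/
lemma differentiable_intervalIntegral {g : ℂ → ℝ → ℂ} (hc : Continuous (Function.uncurry g))
    (hd : ∀ t, Differentiable ℂ fun z => g z t) (α β : ℝ) :
    Differentiable ℂ fun z => ∫ t in α..β, g z t := by
  intro z₀
  -- Unit circles about points of the unit ball at `z₀` stay in the ball of radius 2, so Cauchy's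
  -- estimate bounds the `z`-derivative uniformly in `t`.
  have hK : IsCompact (Metric.closedBall z₀ 2 ×ˢ Set.uIcc α β) :=
    (isCompact_closedBall z₀ 2).prod isCompact_uIcc
  obtain ⟨M, hM⟩ := hK.exists_bound_of_continuousOn hc.continuousOn
  have hcz : ∀ z, Continuous fun t => g z t := fun z =>
    hc.comp (by fun_prop : Continuous fun t : ℝ => (z, t))
  have hm : Measurable fun t => deriv (fun z => g z t) z₀ := by
    have h1 : Continuous (Function.uncurry fun (t : ℝ) (z : ℂ) => g z t) :=
      hc.comp continuous_swap
    exact (measurable_deriv_with_param h1).comp (by fun_prop : Measurable fun t : ℝ => (t, z₀))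
  refine (intervalIntegral.hasDerivAt_integral_of_dominated_loc_of_deriv_le
    (F' := fun z t => deriv (fun z => g z t) z) (bound := fun _ => M / 1)
    (Metric.ball_mem_nhds z₀ one_pos) (Eventually.of_forall fun z => (hcz z).aestronglyMeasurable)
    ((hcz z₀).intervalIntegrable _ _) hm.aestronglyMeasurable ?_ intervalIntegrable_const
    ?_).2.differentiableAt
  · refine ae_of_all _ fun t ht z hz => ?_
    refine Complex.norm_deriv_le_of_forall_mem_sphere_norm_le one_pos
      (hd t).diffContOnCl fun y hy => ?_
    refine hM (y, t) ⟨?_, Set.uIoc_subset_uIcc ht⟩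
    rw [Metric.mem_closedBall]
    rw [mem_sphere_iff_norm, ← dist_eq_norm] at hy
    rw [Metric.mem_ball] at hz
    linarith [dist_triangle y z z₀]
  · exact ae_of_all _ fun t _ z _ => (hd t z).hasDerivAt

lemma norm_exp_two_pi_mul (t x : ℝ) : ‖exp (2 * π * I * t * x)‖ = 1 := by
  rw [show 2 * (π : ℂ) * I * t * x = ((2 * π * t * x : ℝ) : ℂ) * I by push_cast; ring]
  exact Complex.norm_exp_ofReal_mul_I _

lemma integrable_of_decay {f : ℂ → ℂ} (hf : Continuous f) {M : ℝ}
    (hM : ∀ x : ℝ, ‖f x‖ * (1 + x ^ 2) ≤ M) : Integrable fun x : ℝ => f x := by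
  refine (integrable_inv_one_add_sq.const_mul M).mono' (by fun_prop) (ae_of_all _ fun x => ?_)
  rw [← div_eq_mul_inv, le_div_iff₀ (by positivity)]
  exact hM x

/-- The Paley–Wiener representation of an entire function of exponential type `2πL` with quadratic
decay on the real line. -/
lemma exists_fourier_repr {L M : ℝ} (hL : 0 < L) {f : ℂ → ℂ} (hf : Differentiable ℂ f)
    (hg : HasGrowth (2 * π * L) f) (hM : ∀ x : ℝ, ‖f x‖ * (1 + x ^ 2) ≤ M) :
    ∃ φ : ℝ → ℂ, Continuous φ ∧ Integrable φ ∧ (∀ t ∉ Set.Ioc (-L) L, φ t = 0) ∧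
      (∀ t : ℝ, φ t = ∫ x : ℝ, f x * exp (2 * π * I * (-t : ℝ) * x)) ∧
      ∀ z, f z = ∫ t, φ t * exp (2 * π * I * t * z) := by
  have hfc := hf.continuous
  have hint : Integrable fun x : ℝ => f x := integrable_of_decay hfc hM
  set φ : ℝ → ℂ := fun t => ∫ x : ℝ, f x * exp (2 * π * I * (-t : ℝ) * x) with hφ
  have hφc : Continuous φ := by
    refine continuous_of_dominated (bound := fun x : ℝ => ‖f x‖) (fun t => ?_)
      (fun t => ae_of_all _ fun x => ?_) hint.norm (ae_of_all _ fun x => ?_)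
    · exact Continuous.aestronglyMeasurable (by fun_prop)
    · rw [norm_mul, norm_exp_two_pi_mul, mul_one]
    · fun_prop
  have hpos : ∀ t, L < |t| → φ t = 0 := fun t ht => by
    refine integral_twist_eq_zero hf hg hM ?_
    rw [abs_neg]
    have := Real.pi_pos
    gcongr
  have hzero : ∀ t ∉ Set.Ioc (-L) L, φ t = 0 := by
    -- Contour shifting gives vanishing only for |t| > L. The half-open interval also excludes t =
    -- -L, which is reached by continuity of `φ`.
    have hcl : closure {t : ℝ | L < |t|} ⊆ {t | φ t = 0} :=
      closure_minimal (fun t ht => hpos t ht) (isClosed_eq hφc continuous_const)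
    intro t ht
    refine hcl ?_
    rw [Set.mem_Ioc, not_and_or, not_lt, not_le] at ht
    rcases ht with ht | ht
    · have h1 : t ∈ closure (Set.Iio (-L)) := by rw [closure_Iio]; exact ht
      refine closure_mono (fun s hs => ?_) h1
      rw [Set.mem_Iio] at hs
      change L < |s|
      rw [lt_abs]
      right; linarith
    · exact subset_closure (lt_abs.2 (Or.inl ht))
  have hφi : Integrable φ := by
    refine hφc.integrable_of_hasCompactSupport ?_
    refine HasCompactSupport.intro (isCompact_Icc (a := -L) (b := L)) fun t ht => hzero t ?_
    exact fun h => ht (Set.Ioc_subset_Icc_self h)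
  refine ⟨φ, hφc, hφi, hzero, fun t => rfl, ?_⟩
  have hφF : FourierTransform.fourier (fun x : ℝ => f x) = φ := by
    ext t
    rw [Real.fourier_eq']
    simp only [hφ]
    congr 1; ext x
    rw [smul_eq_mul, mul_comm]
    congr 2
    simp
    ring
  have hreal : ∀ x : ℝ, f x = ∫ t, φ t * exp (2 * π * I * t * x) := by
    intro x
    have h1 := Continuous.fourierInv_fourier_eq (f := fun x : ℝ => f x) (by fun_prop) hint
      (by rw [hφF]; exact hφi)
    have h2 : _ = f x := congrFun h1 x
    rw [← h2, hφF, Real.fourierInv_eq']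
    congr 1; ext t
    rw [smul_eq_mul, mul_comm]
    congr 2
    simp
    ring
  have hrestr : ∀ z : ℂ, ∫ t, φ t * exp (2 * π * I * t * z)
      = ∫ t in (-L)..L, φ t * exp (2 * π * I * t * z) := by
    intro z
    rw [intervalIntegral.integral_of_le (by linarith),
      setIntegral_eq_integral_of_forall_compl_eq_zero]
    intro t ht
    rw [hzero t ht, zero_mul]
  refine congrFun (eq_of_eq_on_real (g := fun z => ∫ t, φ t * exp (2 * π * I * t * z)) hf ?_ hreal)
  simp only [hrestr]
  refine differentiable_intervalIntegral (g := fun z t => φ t * exp (2 * π * I * t * z)) ?_ ?_ _ _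
  · simp only [Function.uncurry_def]
    fun_prop
  · intro t
    fun_prop

/-! ### The integral equation characterising a reproducing function -/

lemma ofReal_sinc_eq_integral (x : ℝ) :
    (Real.sinc (2 * π * x) : ℂ) = 1 / 2 * ∫ s in (-1 : ℝ)..1, exp (2 * π * I * (-s : ℝ) * x) := by
  by_cases hx : x = 0
  · subst hx
    simp
    norm_num
  · have hx' : (x : ℂ) ≠ 0 := by exact_mod_cast hx
    have hp : (π : ℂ) ≠ 0 := by exact_mod_cast Real.pi_ne_zero
    rw [Real.sinc_of_ne_zero (by have := Real.pi_ne_zero; positivity)]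
    have h1 : ∫ s in (-1 : ℝ)..1, exp (2 * π * I * (-s : ℝ) * x)
        = ∫ s in (-1 : ℝ)..1, exp ((-(2 * π * I * x)) * s) := by
      congr 1; ext s; congr 1; push_cast; ring
    rw [h1, integral_exp_mul_complex (by simp [hx, Real.pi_ne_zero])]
    push_cast
    rw [Complex.sin]
    rw [show -(2 * (π : ℂ) * I * x) * 1 = -(2 * π * x) * I by ring,
      show -(2 * (π : ℂ) * I * x) * -1 = 2 * π * x * I by ring]
    have := I_ne_zero
    field_simp
    linear_combination (exp (-(2 * (π : ℂ) * x * I)) - exp (2 * (π : ℂ) * x * I)) * I_sq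

/-- Multiplying by `W` convolves the Fourier transform with `δ + 1_[-1,1] / 2`. -/
lemma fourier_mul_W {f : ℂ → ℂ} (hfc : Continuous f) (hint : Integrable fun x : ℝ => f x)
    {φ : ℝ → ℂ} (hφ : ∀ t : ℝ, φ t = ∫ x : ℝ, f x * exp (2 * π * I * (-t : ℝ) * x)) (t : ℝ) :
    ∫ x : ℝ, f x * W x * exp (2 * π * I * (-t : ℝ) * x)
      = φ t + 1 / 2 * ∫ s in (t - 1)..(t + 1), φ s := by
  have hsc := Real.continuous_sinc
  have hI1 : Integrable fun x : ℝ => f x * exp (2 * π * I * (-t : ℝ) * x) := by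
    refine hint.norm.mono' (Continuous.aestronglyMeasurable (by fun_prop)) (ae_of_all _ fun x => ?_)
    rw [norm_mul, norm_exp_two_pi_mul, mul_one]
  have hI2 : Integrable fun x : ℝ => f x * exp (2 * π * I * (-t : ℝ) * x) *
      (Real.sinc (2 * π * x) : ℂ) := by
    refine hint.norm.mono' (Continuous.aestronglyMeasurable (by fun_prop)) (ae_of_all _ fun x => ?_)
    rw [norm_mul, norm_mul, norm_exp_two_pi_mul, mul_one, Complex.norm_real]
    exact mul_le_of_le_one_right (norm_nonneg _) (Real.abs_sinc_le_one _)
  have h1 : (fun x : ℝ => f x * W x * exp (2 * π * I * (-t : ℝ) * x)) = fun x : ℝ =>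
      f x * exp (2 * π * I * (-t : ℝ) * x) + f x * exp (2 * π * I * (-t : ℝ) * x) *
      (Real.sinc (2 * π * x) : ℂ) := by
    ext x; simp only [W]; push_cast; ring
  rw [h1, integral_add hI1 hI2, ← hφ]
  congr 1
  have h2 : ∀ x : ℝ, f x * exp (2 * π * I * (-t : ℝ) * x) * (Real.sinc (2 * π * x) : ℂ)
      = 1 / 2 * ∫ s in (-1 : ℝ)..1, f x * exp (2 * π * I * (-(t + s) : ℝ) * x) := by
    intro x
    rw [ofReal_sinc_eq_integral, mul_left_comm, ← intervalIntegral.integral_const_mul]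
    congr 2
    ext s
    rw [mul_assoc, ← Complex.exp_add]
    congr 2; push_cast; ring
  simp only [h2]
  rw [integral_const_mul]
  congr 1
  simp only [intervalIntegral.integral_of_le (show (-1 : ℝ) ≤ 1 by norm_num)]
  rw [integral_integral_swap]
  · simp only [← hφ]
    rw [← intervalIntegral.integral_of_le (show (-1 : ℝ) ≤ 1 by norm_num),
      intervalIntegral.integral_comp_add_left (fun s => φ s) t]
    rfl
  · have h3 : Integrable (fun p : ℝ × ℝ => ‖f p.1‖ * 1)
        (volume.prod (volume.restrict (Set.Ioc (-1 : ℝ) 1))) :=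
      hint.norm.mul_prod (integrable_const (1 : ℝ))
    refine h3.mono' (Continuous.aestronglyMeasurable ?_) (ae_of_all _ fun p => ?_)
    · simp only [Function.uncurry_def]
      fun_prop
    · simp only [Function.uncurry_def]
      rw [norm_mul, norm_exp_two_pi_mul]

/-- If `h` solves the integral equation `h + 1_[-1,1] * h / 2 = exp (-2πi w̄ s)` on `(-L, L]`, then
its Fourier transform reproduces at `w` the functions of type `2πL` with quadratic decay. -/
lemma reproduces_of_integral_equation {L M : ℝ} (hL : 0 < L) {f : ℂ → ℂ} (hf : Differentiable ℂ f)
    (hg : HasGrowth (2 * π * L) f) (hM : ∀ x : ℝ, ‖f x‖ * (1 + x ^ 2) ≤ M)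
    {h : ℝ → ℂ} (hh : Integrable h) {w : ℂ} {k : ℂ → ℂ}
    (hk : ∀ x : ℝ, k x = ∫ t, h t * exp (2 * π * I * t * x))
    (heq : ∀ s ∈ Set.Ioc (-L) L,
      h s + 1 / 2 * ∫ t in (s - 1)..(s + 1), h t = exp (-2 * π * I * conj w * s)) :
    f w = innerW f k := by
  obtain ⟨φ, hφc, hφi, hφ0, hφ, hrep⟩ := exists_fourier_repr hL hf hg hM
  have hfc := hf.continuous
  have hWc := continuous_W
  have hint : Integrable fun x : ℝ => f x := integrable_of_decay hfc hM
  have hfW : Integrable fun x : ℝ => f x * W x := by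
    refine (hint.norm.const_mul 2).mono' (Continuous.aestronglyMeasurable (by fun_prop))
      (ae_of_all _ fun x => ?_)
    rw [norm_mul, Complex.norm_real, Real.norm_of_nonneg (W_pos x).le, mul_comm]
    exact mul_le_mul_of_nonneg_right (W_le_two x) (norm_nonneg _)
  have hhc : Integrable fun t => conj (h t) := by
    simpa using (Complex.conjCLE.toContinuousLinearMap.integrable_comp hh)
  have hphase : ∀ t x : ℝ, conj (exp (2 * π * I * t * x)) = exp (2 * π * I * (-t : ℝ) * x) := by
    intro t x
    rw [← Complex.exp_conj]
    congr 1
    simp [Complex.conj_ofNat]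
  have step1 : innerW f k = ∫ t, conj (h t) *
      ∫ x : ℝ, f x * W x * exp (2 * π * I * (-t : ℝ) * x) := by
    unfold innerW
    have h1 : ∀ x : ℝ, f x * conj (k x) * (W x : ℂ)
        = ∫ t, f x * W x * (conj (h t) * exp (2 * π * I * (-t : ℝ) * x)) := by
      intro x
      rw [hk, ← integral_conj, integral_const_mul]
      simp only [map_mul, hphase]
      ring
    simp only [h1]
    rw [integral_integral_swap]
    · congr 1; ext t
      rw [← integral_const_mul]
      congr 1; ext x; ring
    · refine (hfW.norm.mul_prod hhc.norm).mono' ?_ (ae_of_all _ fun p => ?_)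
      · have h2 : AEStronglyMeasurable (fun p : ℝ × ℝ => f p.1 * W p.1 * conj (h p.2))
            (volume.prod volume) := (hfW.mul_prod hhc).aestronglyMeasurable
        have h3 : AEStronglyMeasurable (fun p : ℝ × ℝ => exp (2 * π * I * (-p.2 : ℝ) * p.1))
            (volume.prod volume) := Continuous.aestronglyMeasurable (by fun_prop)
        refine (h2.mul h3).congr (ae_of_all _ fun p => ?_)
        simp [Function.uncurry_def, mul_assoc]
      · simp only [Function.uncurry_def]
        rw [norm_mul, norm_mul (conj (h p.2)), norm_exp_two_pi_mul, mul_one]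
  -- Self-adjointness of the convolution: by Fubini with the indicator of |s - t| ≤ 1, which is
  -- symmetric in `s` and `t`.
  have step2 : ∫ t, conj (h t) * ∫ s in (t - 1)..(t + 1), φ s
      = ∫ s, φ s * ∫ t in (s - 1)..(s + 1), conj (h t) := by
    have hin : ∀ (g : ℝ → ℂ) (t : ℝ), ∫ s in (t - 1)..(t + 1), g s
        = ∫ s, if |s - t| ≤ 1 then g s else 0 := by
      intro g t
      rw [intervalIntegral.integral_of_le (by linarith), ← integral_Icc_eq_integral_Ioc,
        ← integral_indicator measurableSet_Icc]
      congr 1; ext s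
      simp only [Set.indicator_apply, Set.mem_Icc]
      congr 1
      rw [abs_le]
      apply propext
      constructor <;> rintro ⟨h1, h2⟩ <;> constructor <;> linarith
    simp only [hin, ← integral_const_mul]
    rw [integral_integral_swap]
    · congr 1; ext s; congr 1; ext t
      rw [abs_sub_comm]
      split_ifs <;> ring
    · have h2 : Integrable (fun p : ℝ × ℝ => conj (h p.1) * φ p.2) (volume.prod volume) :=
        hhc.mul_prod hφi
      have h3 : Integrable (Set.indicator {p : ℝ × ℝ | |p.2 - p.1| ≤ 1}
          fun p : ℝ × ℝ => conj (h p.1) * φ p.2) (volume.prod volume) := by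
        refine h2.indicator (measurableSet_le ?_ measurable_const)
        exact (continuous_abs.comp (by fun_prop)).measurable
      refine h3.congr (ae_of_all _ fun p => ?_)
      simp only [Set.indicator_apply, Function.uncurry_def, Set.mem_ofPred_eq]
      split_ifs <;> simp
  have hIntW : ∀ t, ∫ x : ℝ, f x * W x * exp (2 * π * I * (-t : ℝ) * x)
      = φ t + 1 / 2 * ∫ s in (t - 1)..(t + 1), φ s := fourier_mul_W hfc hint hφ
  have hbd : ∀ (g : ℝ → ℂ), Integrable g → ∀ t, ‖∫ s in (t - 1)..(t + 1), g s‖ ≤ ∫ s, ‖g s‖ := by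
    intro g hgi t
    rw [intervalIntegral.integral_of_le (by linarith)]
    exact (norm_integral_le_integral_norm _).trans
      (setIntegral_le_integral hgi.norm (ae_of_all _ fun s => norm_nonneg _))
  have hcont : ∀ (g : ℝ → ℂ), Integrable g → Continuous fun t => ∫ s in (t - 1)..(t + 1), g s := by
    intro g hgi
    have h1 : ∀ t : ℝ, ∫ s in (t - 1)..(t + 1), g s
        = (∫ s in (0 : ℝ)..(t + 1), g s) - ∫ s in (0 : ℝ)..(t - 1), g s := fun t =>
      (intervalIntegral.integral_interval_sub_left hgi.intervalIntegrable
        hgi.intervalIntegrable).symm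
    simp only [h1]
    have h2 : Continuous fun t => ∫ s in (0 : ℝ)..t, g s :=
      intervalIntegral.continuous_primitive (fun _ _ => hgi.intervalIntegrable) 0
    exact (h2.comp (by fun_prop)).sub (h2.comp (by fun_prop))
  have hprod : ∀ (g₁ g₂ : ℝ → ℂ), Integrable g₁ → Integrable g₂ →
      Integrable fun t => g₁ t * ∫ s in (t - 1)..(t + 1), g₂ s := by
    intro g₁ g₂ h₁ h₂
    have := h₁.bdd_mul (hcont g₂ h₂).aestronglyMeasurable (ae_of_all _ (hbd g₂ h₂))
    refine this.congr (ae_of_all _ fun t => mul_comm _ _)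
  obtain ⟨N, hN⟩ : ∃ N, ∀ t, ‖φ t‖ ≤ N := by
    obtain ⟨N, hN⟩ := (isCompact_Icc (a := -L) (b := L)).exists_bound_of_continuousOn
      hφc.continuousOn
    refine ⟨max N 0, fun t => ?_⟩
    by_cases ht : t ∈ Set.Ioc (-L) L
    · exact (hN t (Set.Ioc_subset_Icc_self ht)).trans (le_max_left _ _)
    · rw [hφ0 t ht]; simp
  have hhφ : Integrable fun t => φ t * conj (h t) :=
    hhc.bdd_mul hφc.aestronglyMeasurable (ae_of_all _ hN)
  have e1 : (fun t => conj (h t) * (φ t + 1 / 2 * ∫ s in (t - 1)..(t + 1), φ s))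
      = fun t => φ t * conj (h t) + 1 / 2 * (conj (h t) * ∫ s in (t - 1)..(t + 1), φ s) := by
    ext t; ring
  -- The conjugated integral equation is used only on (-L, L]; elsewhere both sides vanish with `φ`.
  have e2 : ∀ t, φ t * conj (h t) + 1 / 2 * (φ t * ∫ s in (t - 1)..(t + 1), conj (h s))
      = φ t * exp (2 * π * I * t * w) := by
    intro t
    by_cases ht : t ∈ Set.Ioc (-L) L
    · have h1 := congrArg conj (heq t ht)
      rw [map_add, map_mul, ← Complex.exp_conj] at h1
      have h2 : conj (∫ s in (t - 1)..(t + 1), h s) = ∫ s in (t - 1)..(t + 1), conj (h s) := by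
        rw [intervalIntegral.integral_of_le (by linarith),
          intervalIntegral.integral_of_le (by linarith), integral_conj]
      rw [h2] at h1
      simp only [map_div₀, map_one, map_ofNat, map_mul, map_neg, conj_I, conj_ofReal, conj_conj]
        at h1
      rw [show 2 * (π : ℂ) * I * t * w = -2 * π * -I * w * t by ring, ← h1]
      ring
    · simp [hφ0 t ht]
  rw [step1]
  simp only [hIntW]
  rw [e1, integral_add hhφ ((hprod _ _ hhc hφi).const_mul _), integral_const_mul, step2,
    ← integral_const_mul, ← integral_add hhφ ((hprod _ _ hφi hhc).const_mul _)]
  simp only [e2]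
  exact hrep w

/-! ### From quadratic decay to square integrability -/

/-- The entire function `z ↦ sin (σz/2) / (σz/2)`, as an integral. -/
def mollifier (σ : ℝ) (z : ℂ) : ℂ := 1 / 2 * ∫ t in (-1 : ℝ)..1, exp (I * (σ / 2) * z * t)

lemma differentiable_mollifier (σ : ℝ) : Differentiable ℂ (mollifier σ) := by
  refine (differentiable_intervalIntegral (g := fun z t => exp (I * (σ / 2) * z * t)) ?_ ?_
    _ _).const_mul _
  · simp only [Function.uncurry_def]; fun_prop
  · intro t; fun_prop

lemma mollifier_zero (σ : ℝ) : mollifier σ 0 = 1 := by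
  simp [mollifier]; norm_num

lemma norm_mollifier_le {σ : ℝ} (hσ : 0 ≤ σ) (z : ℂ) :
    ‖mollifier σ z‖ ≤ Real.exp (σ / 2 * ‖z‖) := by
  have h : ‖∫ t in (-1 : ℝ)..1, exp (I * (σ / 2) * z * t)‖
      ≤ Real.exp (σ / 2 * ‖z‖) * |1 - (-1)| := by
    refine intervalIntegral.norm_integral_le_of_norm_le_const fun t ht => ?_
    rw [Set.uIoc_of_le (by norm_num)] at ht
    refine (Complex.norm_exp_le_exp_norm _).trans ?_
    gcongr
    rw [norm_mul, norm_mul, norm_mul, norm_I, one_mul, Complex.norm_real, Real.norm_eq_abs]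
    have h1 : |t| ≤ 1 := abs_le.2 ⟨ht.1.le, ht.2⟩
    have h2 : ‖(σ / 2 : ℂ)‖ = σ / 2 := by
      rw [norm_div, Complex.norm_real, Real.norm_of_nonneg hσ]; simp
    rw [h2]
    exact mul_le_of_le_one_right (by positivity) h1
  rw [mollifier, norm_mul]
  have e : |(1 : ℝ) - (-1)| = 2 := by norm_num
  rw [e] at h
  norm_num
  linarith

lemma norm_mollifier_real_le_one (σ x : ℝ) : ‖mollifier σ x‖ ≤ 1 := by
  have h : ‖∫ t in (-1 : ℝ)..1, exp (I * (σ / 2) * x * t)‖ ≤ 1 * |1 - (-1)| := by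
    refine intervalIntegral.norm_integral_le_of_norm_le_const fun t _ => le_of_eq ?_
    rw [show I * (σ / 2) * x * (t : ℂ) = ((σ / 2 * x * t : ℝ) : ℂ) * I by push_cast; ring]
    exact Complex.norm_exp_ofReal_mul_I _
  rw [mollifier, norm_mul]
  have e : |(1 : ℝ) - (-1)| = 2 := by norm_num
  rw [e] at h
  norm_num
  linarith

lemma norm_mollifier_real_mul_le {σ : ℝ} (hσ : 0 < σ) (x : ℝ) :
    ‖mollifier σ x‖ * (σ / 2 * |x|) ≤ 1 := by
  by_cases hx : x = 0
  · simp [hx]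
  have hc : I * (σ / 2) * (x : ℂ) ≠ 0 := by
    simp [hσ.ne', hx]
  have hn : ‖I * (σ / 2) * (x : ℂ)‖ = σ / 2 * |x| := by
    rw [norm_mul, norm_mul, norm_I, one_mul, Complex.norm_real, norm_div, Complex.norm_real,
      Real.norm_of_nonneg hσ.le, Real.norm_eq_abs]
    simp
  rw [mollifier, integral_exp_mul_complex hc, norm_mul, norm_div (exp _ - _), hn]
  have hpos : 0 < σ / 2 * |x| := by have := abs_pos.2 hx; positivity
  have he : ∀ t : ℝ, ‖exp (I * (σ / 2) * x * t)‖ = 1 := fun t => by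
    rw [show I * (σ / 2) * x * (t : ℂ) = ((σ / 2 * x * t : ℝ) : ℂ) * I by push_cast; ring]
    exact Complex.norm_exp_ofReal_mul_I _
  have h2 := norm_sub_le (exp (I * (σ / 2) * x * (1 : ℝ))) (exp (I * (σ / 2) * x * (-1 : ℝ)))
  rw [he, he] at h2
  rw [mul_assoc, div_mul_cancel₀ _ hpos.ne']
  norm_num at h2 ⊢
  linarith

lemma norm_mollifier_sq_mul_le {σ : ℝ} (hσ : 0 < σ) {ε : ℝ} (hε : 0 < ε) (x : ℝ) :
    ‖mollifier σ (ε * x : ℝ) ^ 2‖ * (1 + x ^ 2) ≤ 1 + (2 / (σ * ε)) ^ 2 := by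
  have h1 := norm_mollifier_real_le_one σ (ε * x)
  have h2 := norm_mollifier_real_mul_le hσ (ε * x)
  rw [norm_pow]
  set m := ‖mollifier σ (ε * x : ℝ)‖
  have hm : 0 ≤ m := norm_nonneg _
  rw [abs_mul, abs_of_pos hε] at h2
  have h3 : m * |x| ≤ 2 / (σ * ε) := by
    rw [le_div_iff₀ (by positivity)]
    nlinarith
  have h4 : (m * |x|) ^ 2 ≤ (2 / (σ * ε)) ^ 2 := by gcongr
  rw [mul_pow, sq_abs] at h4
  nlinarith

/-- Dominated convergence requires a majorant free of ε. The substitution y = (1-ε)x moves the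
dilation from `f`, which has no pointwise decay, to `κ`, whose bound N/(1+|y|) survives because
(1-ε)⁻¹ ≥ 1. -/
lemma tendsto_integral_dilate {σ N : ℝ} {f : ℂ → ℂ} (hf : Continuous f) {κ : ℝ → ℂ}
    (hκ : Continuous κ) (hN : ∀ x, ‖κ x‖ * (1 + |x|) ≤ N)
    (hfi : Integrable fun x : ℝ => ‖f x‖ / (1 + |x|)) :
    Tendsto (fun ε : ℝ => ∫ x : ℝ, mollifier σ (ε * x : ℝ) ^ 2 * f ((1 - ε) * x : ℝ) * κ x)
      (𝓝[>] 0) (𝓝 (∫ x : ℝ, f x * κ x)) := by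
  have hm : Continuous (mollifier σ) := (differentiable_mollifier σ).continuous
  have hN0 : 0 ≤ N := le_trans (by positivity) (hN 0)
  have hev : ∀ᶠ ε : ℝ in 𝓝[>] 0, ε ∈ Set.Ioo (0 : ℝ) 1 := Ioo_mem_nhdsGT one_pos
  have heq : ∀ᶠ ε : ℝ in 𝓝[>] 0,
      ((1 - ε)⁻¹ : ℝ) • (∫ y : ℝ, mollifier σ (ε * ((1 - ε)⁻¹ * y) : ℝ) ^ 2 * f y *
        κ ((1 - ε)⁻¹ * y))
      = ∫ x : ℝ, mollifier σ (ε * x : ℝ) ^ 2 * f ((1 - ε) * x : ℝ) * κ x := by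
    filter_upwards [hev] with ε hε
    have h1 : 0 < 1 - ε := by linarith [hε.2]
    have h2 := Measure.integral_comp_mul_left (fun y : ℝ =>
      mollifier σ (ε * ((1 - ε)⁻¹ * y) : ℝ) ^ 2 * f y * κ ((1 - ε)⁻¹ * y)) (1 - ε)
    rw [abs_of_pos (inv_pos.2 h1)] at h2
    rw [← h2]
    congr 1; ext x
    rw [inv_mul_cancel_left₀ h1.ne']
  refine Tendsto.congr' heq ?_
  have hlim : Tendsto (fun ε : ℝ => ∫ y : ℝ, mollifier σ (ε * ((1 - ε)⁻¹ * y) : ℝ) ^ 2 * f y *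
        κ ((1 - ε)⁻¹ * y)) (𝓝[>] 0) (𝓝 (∫ x : ℝ, f x * κ x)) := by
    refine tendsto_integral_filter_of_dominated_convergence
      (fun y : ℝ => N * (‖f y‖ / (1 + |y|))) ?_ ?_ (hfi.const_mul N) ?_
    · exact Eventually.of_forall fun ε => Continuous.aestronglyMeasurable (by fun_prop)
    · filter_upwards [hev] with ε hε
      refine ae_of_all _ fun y => ?_
      have h1 : 0 < 1 - ε := by linarith [hε.2]
      have h3 : 1 ≤ (1 - ε)⁻¹ := (one_le_inv₀ h1).2 (by linarith [hε.1])
      have h4 : ‖κ ((1 - ε)⁻¹ * y)‖ ≤ N / (1 + |y|) := by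
        rw [le_div_iff₀ (by positivity)]
        refine le_trans ?_ (hN ((1 - ε)⁻¹ * y))
        refine mul_le_mul_of_nonneg_left (add_le_add_right ?_ 1) (norm_nonneg _)
        rw [abs_mul, abs_of_pos (inv_pos.2 h1)]
        exact le_mul_of_one_le_left (abs_nonneg _) h3
      have h5 := norm_mollifier_real_le_one σ (ε * ((1 - ε)⁻¹ * y))
      rw [norm_mul, norm_mul, norm_pow]
      calc _ ≤ 1 ^ 2 * ‖f y‖ * (N / (1 + |y|)) := by gcongr
        _ = _ := by ring
    · refine ae_of_all _ fun y => ?_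
      have h6 : ContinuousAt (fun ε : ℝ => mollifier σ (ε * ((1 - ε)⁻¹ * y) : ℝ) ^ 2 * f y *
        κ ((1 - ε)⁻¹ * y)) 0 := by
        have h7 : ContinuousAt (fun ε : ℝ => (1 - ε)⁻¹) 0 := by
          refine ContinuousAt.inv₀ (by fun_prop) (by norm_num)
        have h8 : ContinuousAt (fun ε : ℝ => mollifier σ (ε * ((1 - ε)⁻¹ * y) : ℝ)) 0 := by
          refine ContinuousAt.comp (g := mollifier σ) hm.continuousAt ?_
          refine ContinuousAt.comp (g := fun x : ℝ => (x : ℂ))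
            Complex.continuous_ofReal.continuousAt ?_
          fun_prop
        have h9 : ContinuousAt (fun ε : ℝ => κ ((1 - ε)⁻¹ * y)) 0 := by
          refine ContinuousAt.comp (g := κ) hκ.continuousAt ?_
          fun_prop
        exact ((h8.pow 2).mul continuousAt_const).mul h9
      have h10 := h6.tendsto.mono_left (nhdsWithin_le_nhds (s := Set.Ioi 0))
      simpa [mollifier_zero] using h10
  have hc : Tendsto (fun ε : ℝ => ((1 - ε)⁻¹ : ℝ)) (𝓝[>] 0) (𝓝 1) := by
    have h7 : ContinuousAt (fun ε : ℝ => (1 - ε)⁻¹) 0 :=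
      ContinuousAt.inv₀ (by fun_prop) (by norm_num)
    simpa using h7.tendsto.mono_left (nhdsWithin_le_nhds (s := Set.Ioi 0))
  simpa using hc.smul hlim

/-- A representation formula `f w = ∫ f κ` extends from functions with quadratic decay to functions
bounded on the real line. -/
lemma repr_of_bounded {σ N B : ℝ} (hσ : 0 < σ) {w : ℂ} {κ : ℝ → ℂ}
    (hκ : Continuous κ) (hN : ∀ x, ‖κ x‖ * (1 + |x|) ≤ N)
    (hrep : ∀ f : ℂ → ℂ, Differentiable ℂ f → HasGrowth σ f →
      (∃ M : ℝ, ∀ x : ℝ, ‖f x‖ * (1 + x ^ 2) ≤ M) → f w = ∫ x : ℝ, f x * κ x)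
    {f : ℂ → ℂ} (hf : Differentiable ℂ f) (hg : HasGrowth σ f) (hB : ∀ x : ℝ, ‖f x‖ ≤ B)
    (hfi : Integrable fun x : ℝ => ‖f x‖ / (1 + |x|)) : f w = ∫ x : ℝ, f x * κ x := by
  have hm := differentiable_mollifier σ
  have hlim := tendsto_integral_dilate (σ := σ) hf.continuous hκ hN hfi
  have hev : ∀ᶠ ε : ℝ in 𝓝[>] 0, ε ∈ Set.Ioo (0 : ℝ) 1 := Ioo_mem_nhdsGT one_pos
  have hlim' : Tendsto (fun ε : ℝ => mollifier σ (ε * w) ^ 2 * f ((1 - ε) * w)) (𝓝[>] 0)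
      (𝓝 (f w)) := by
    have h1 : Continuous fun ε : ℝ => mollifier σ (ε * w) ^ 2 * f ((1 - ε) * w) := by
      have := hm.continuous
      have := hf.continuous
      fun_prop
    have h2 := (h1.tendsto 0).mono_left (nhdsWithin_le_nhds (s := Set.Ioi 0))
    simpa [mollifier_zero] using h2
  refine tendsto_nhds_unique hlim' (hlim.congr' ?_)
  filter_upwards [hev] with ε hε
  have h1ε : 0 < 1 - ε := by linarith [hε.2]
  -- The squared mollifier has type εσ and supplies quadratic decay; dilating `f` lowers its type to
  -- (1-ε)σ. The product is again of type σ.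
  have := hrep (fun z => mollifier σ (ε * z) ^ 2 * f ((1 - ε) * z))
    (((hm.comp (by fun_prop)).pow 2).mul (hf.comp (by fun_prop))) ?_ ?_
  · rw [this]
    congr 1; ext x
    push_cast
    rfl
  · intro η hη
    obtain ⟨M, hM, hb⟩ := hg η hη
    refine ⟨M, hM, fun z => ?_⟩
    have h2 := norm_mollifier_le hσ.le (ε * z)
    have h3 := hb ((1 - ε) * z)
    have e1 : ‖(ε : ℂ) * z‖ = ε * ‖z‖ := by
      rw [norm_mul, Complex.norm_real, Real.norm_of_nonneg hε.1.le]
    have e2 : ‖(1 - ε : ℂ) * z‖ = (1 - ε) * ‖z‖ := by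
      rw [norm_mul, show (1 - ε : ℂ) = ((1 - ε : ℝ) : ℂ) by push_cast; rfl, Complex.norm_real,
        Real.norm_of_nonneg h1ε.le]
    rw [e1] at h2
    rw [e2] at h3
    rw [norm_mul, norm_pow]
    calc _ ≤ Real.exp (σ / 2 * (ε * ‖z‖)) ^ 2 * (M * Real.exp ((σ + η) * ((1 - ε) * ‖z‖))) := by
          gcongr
      _ = M * Real.exp ((σ + η) * ‖z‖ - η * (ε * ‖z‖)) := by
        rw [← Real.exp_nat_mul, mul_left_comm, ← Real.exp_add]
        congr 2; push_cast; ring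
      _ ≤ _ := by
        gcongr
        have := hε.1
        have : 0 ≤ η * (ε * ‖z‖) := by positivity
        linarith
  · refine ⟨(1 + (2 / (σ * ε)) ^ 2) * B, fun x => ?_⟩
    have h2 := norm_mollifier_sq_mul_le hσ hε.1 x
    have h3 := hB ((1 - ε) * x)
    push_cast at h2 h3
    rw [norm_mul, mul_right_comm]
    gcongr

lemma integrable_div_one_add_abs {f : ℂ → ℂ} (hf : Continuous f)
    (hf2 : Integrable fun x : ℝ => ‖f x‖ ^ 2) : Integrable fun x : ℝ => ‖f x‖ / (1 + |x|) := by
  refine (hf2.add integrable_inv_one_add_sq).mono' ?_ (ae_of_all _ fun x => ?_)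
  · refine Continuous.aestronglyMeasurable (Continuous.div (by fun_prop) (by fun_prop) fun x => ?_)
    positivity
  · rw [Real.norm_of_nonneg (by positivity)]
    simp only [Pi.add_apply]
    have h1 : (1 + |x|)⁻¹ ^ 2 ≤ (1 + x ^ 2)⁻¹ := by
      rw [inv_pow]
      gcongr
      nlinarith [abs_nonneg x, sq_abs x]
    rw [div_eq_mul_inv]
    nlinarith [sq_nonneg (‖f x‖ - (1 + |x|)⁻¹), sq_nonneg (‖f x‖), sq_nonneg (1 + |x|)⁻¹]

/-- For Fubini with averages of translates: |f(x+s)κ(x)| ≤ |f(x+s)|² + |κ(x)|², and both squares are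
integrable on the strip, the first by translation invariance. -/
lemma integrable_shift_mul {f : ℂ → ℂ} (hf : Continuous f)
    (hf2 : Integrable fun x : ℝ => ‖f x‖ ^ 2) {κ : ℝ → ℂ} (hκ : Continuous κ) {N : ℝ}
    (hN : ∀ x, ‖κ x‖ * (1 + |x|) ≤ N) (ε : ℝ) :
    Integrable (fun p : ℝ × ℝ => f (p.1 + p.2) * κ p.1)
      (volume.prod (volume.restrict (Set.Ioc 0 ε))) := by
  have hN0 : 0 ≤ N := le_trans (by positivity) (hN 0)
  have h1 : Integrable (fun p : ℝ × ℝ => ‖f (p.1 + p.2)‖ ^ 2)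
      (volume.prod (volume.restrict (Set.Ioc 0 ε))) := by
    rw [integrable_prod_iff' (Continuous.aestronglyMeasurable (by fun_prop))]
    have hs : ∀ s : ℝ, Integrable fun x : ℝ => ‖f (x + s)‖ ^ 2 := fun s => by
      simpa using hf2.comp_add_right s
    refine ⟨ae_of_all _ fun s => hs s, ?_⟩
    have he : ∀ s : ℝ, ∫ x : ℝ, ‖(‖f (x + s)‖ ^ 2)‖ = ∫ x : ℝ, ‖f x‖ ^ 2 := fun s => by
      simp only [norm_pow, norm_norm]
      simpa using integral_add_right_eq_self (fun x : ℝ => ‖f x‖ ^ 2) s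
    simp only [he]
    exact integrable_const _
  have h2 : Integrable (fun p : ℝ × ℝ => ‖κ p.1‖ ^ 2 * (1 : ℝ))
      (volume.prod (volume.restrict (Set.Ioc 0 ε))) := by
    refine Integrable.mul_prod (f := fun x => ‖κ x‖ ^ 2) ?_ (integrable_const (1 : ℝ))
    refine (integrable_inv_one_add_sq.const_mul (N ^ 2)).mono'
      (Continuous.aestronglyMeasurable (by fun_prop)) (ae_of_all _ fun x => ?_)
    rw [Real.norm_of_nonneg (by positivity), ← div_eq_mul_inv, le_div_iff₀ (by positivity)]
    have h3 : (‖κ x‖ * (1 + |x|)) ^ 2 ≤ N ^ 2 := by gcongr; exact hN x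
    refine le_trans ?_ h3
    rw [mul_pow]
    gcongr
    nlinarith [abs_nonneg x, sq_abs x]
  refine (h1.add h2).mono' (Continuous.aestronglyMeasurable (by fun_prop)) (ae_of_all _ fun p => ?_)
  rw [norm_mul]
  simp only [Pi.add_apply]
  nlinarith [sq_nonneg (‖f (p.1 + p.2)‖ - ‖κ p.1‖), sq_nonneg (‖f (p.1 + p.2)‖),
    sq_nonneg (‖κ p.1‖)]

/-- A representation formula `f w = ∫ f κ` extends from functions with quadratic decay to functions
that are square integrable on the real line. -/
lemma repr_of_square_integrable {σ N : ℝ} (hσ : 0 < σ) {w : ℂ} {κ : ℝ → ℂ}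
    (hκ : Continuous κ) (hN : ∀ x, ‖κ x‖ * (1 + |x|) ≤ N)
    (hrep : ∀ f : ℂ → ℂ, Differentiable ℂ f → HasGrowth σ f →
      (∃ M : ℝ, ∀ x : ℝ, ‖f x‖ * (1 + x ^ 2) ≤ M) → f w = ∫ x : ℝ, f x * κ x)
    {f : ℂ → ℂ} (hf : Differentiable ℂ f) (hg : HasGrowth σ f)
    (hf2 : Integrable fun x : ℝ => ‖f x‖ ^ 2) : f w = ∫ x : ℝ, f x * κ x := by
  have hfc := hf.continuous
  have hN0 : 0 ≤ N := le_trans (by positivity) (hN 0)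
  set ψ : ℝ → ℂ := fun s => ∫ x : ℝ, f (x + s) * κ x with hψ
  have hψ' : ∀ s, ψ s = ∫ y : ℝ, f y * κ (y - s) := by
    intro s
    have := integral_add_right_eq_self (μ := volume) (fun y : ℝ => f y * κ (y - s)) s
    rw [← this]
    simp only [hψ]
    congr 1; ext x; push_cast; simp
  have hψc : Continuous ψ := by
    have : ψ = fun s => ∫ y : ℝ, f y * κ (y - s) := funext hψ'
    rw [this, continuous_iff_continuousAt]
    intro s₀
    refine continuousAt_of_dominated (bound := fun y : ℝ => (|s₀| + 2) * N * (‖f y‖ / (1 + |y|)))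
      (Eventually.of_forall fun s => Continuous.aestronglyMeasurable (by fun_prop)) ?_
      ((integrable_div_one_add_abs hfc hf2).const_mul _) (ae_of_all _ fun y => by fun_prop)
    filter_upwards [Metric.ball_mem_nhds s₀ one_pos] with s hs
    refine ae_of_all _ fun y => ?_
    rw [Metric.mem_ball, Real.dist_eq] at hs
    have h1 : ‖κ (y - s)‖ ≤ (|s₀| + 2) * N / (1 + |y|) := by
      rw [le_div_iff₀ (by positivity)]
      have h2 : |y| ≤ |y - s| + |s - s₀| + |s₀| := by
        have e : y = (y - s) + (s - s₀) + s₀ := by ring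
        calc |y| = |(y - s) + (s - s₀) + s₀| := by rw [← e]
          _ ≤ _ := abs_add_three _ _ _
      have h3 : 1 + |y| ≤ (|s₀| + 2) * (1 + |y - s|) := by
        nlinarith [abs_nonneg s₀, abs_nonneg (y - s)]
      calc ‖κ (y - s)‖ * (1 + |y|) ≤ ‖κ (y - s)‖ * ((|s₀| + 2) * (1 + |y - s|)) := by gcongr
        _ = (|s₀| + 2) * (‖κ (y - s)‖ * (1 + |y - s|)) := by ring
        _ ≤ _ := by gcongr; exact hN _
    rw [norm_mul]
    calc _ ≤ ‖f y‖ * ((|s₀| + 2) * N / (1 + |y|)) := by gcongr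
      _ = _ := by ring
  -- The average z ↦ ∫_0^ε f(z+s) ds is bounded on ℝ, since |f| ≤ 1 + |f|², so the bounded case
  -- applies to it. Differentiating the resulting identity at ε = 0 recovers the formula for `f`.
  have hmain : ∀ ε ∈ Set.Icc (0 : ℝ) 1, ∫ s in (0 : ℝ)..ε, (f (w + s) - ψ s) = 0 := by
    rintro ε ⟨hε, hε1⟩
    rw [intervalIntegral.integral_sub
      (Continuous.intervalIntegrable (by fun_prop) _ _) (hψc.intervalIntegrable _ _), sub_eq_zero]
    have hκi : Continuous fun x : ℝ => (((1 + |x|)⁻¹ : ℝ) : ℂ) := by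
      refine continuous_ofReal.comp (Continuous.inv₀ (by fun_prop) fun x => by positivity)
    have hΦ := repr_of_bounded (f := fun z => ∫ s in (0 : ℝ)..ε, f (z + s))
      (B := 1 + ∫ x : ℝ, ‖f x‖ ^ 2) hσ hκ hN hrep ?_ ?_ ?_ ?_
    · rw [hΦ]
      simp only [intervalIntegral.integral_of_le hε]
      have h1 : ∀ x : ℝ, (∫ s in Set.Ioc 0 ε, f (x + s)) * κ x
          = ∫ s in Set.Ioc 0 ε, f (x + s) * κ x := fun x => (integral_mul_const _ _).symm
      simp only [h1]
      rw [integral_integral_swap]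
      exact integrable_shift_mul hfc hf2 hκ hN ε
    · refine differentiable_intervalIntegral (g := fun z s => f (z + s)) ?_ ?_ _ _
      · simp only [Function.uncurry_def]; fun_prop
      · intro s; exact hf.comp (by fun_prop)
    · intro η hη
      obtain ⟨M, hM, hb⟩ := hg η hη
      refine ⟨M * Real.exp (σ + η), by positivity, fun z => ?_⟩
      have h1 : ‖∫ s in (0 : ℝ)..ε, f (z + s)‖
          ≤ M * Real.exp (σ + η) * Real.exp ((σ + η) * ‖z‖) * |ε - 0| := by
        refine intervalIntegral.norm_integral_le_of_norm_le_const fun s hs => ?_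
        rw [Set.uIoc_of_le hε] at hs
        refine (hb _).trans ?_
        rw [mul_assoc, ← Real.exp_add]
        gcongr
        have h2 : ‖z + (s : ℂ)‖ ≤ ‖z‖ + 1 := by
          refine (norm_add_le _ _).trans ?_
          rw [Complex.norm_real, Real.norm_of_nonneg hs.1.le]
          linarith [hs.2]
        nlinarith
      refine h1.trans ?_
      rw [sub_zero, abs_of_nonneg hε]
      exact mul_le_of_le_one_right (by positivity) hε1
    · intro x
      have h1 : ∀ s : ℝ, ‖f (x + s)‖ ≤ 1 + ‖f (x + s)‖ ^ 2 := fun s => by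
        nlinarith [sq_nonneg (‖f (x + s)‖ - 1)]
      have h2 : Integrable fun s : ℝ => ‖f (x + s)‖ ^ 2 := by
        simpa using hf2.comp_add_left x
      calc ‖∫ s in (0 : ℝ)..ε, f (x + s)‖ ≤ ∫ s in (0 : ℝ)..ε, ‖f (x + s)‖ :=
            intervalIntegral.norm_integral_le_integral_norm hε
        _ ≤ ∫ s in (0 : ℝ)..ε, (1 + ‖f (x + s)‖ ^ 2) :=
            intervalIntegral.integral_mono_on hε (Continuous.intervalIntegrable (by fun_prop) _ _)
              (Continuous.intervalIntegrable (by fun_prop) _ _) fun s _ => h1 s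
        _ = ε + ∫ s in (0 : ℝ)..ε, ‖f (x + s)‖ ^ 2 := by
            rw [intervalIntegral.integral_add intervalIntegrable_const
              (Continuous.intervalIntegrable (by fun_prop) _ _)]
            simp
        _ ≤ 1 + ∫ s : ℝ, ‖f (x + s)‖ ^ 2 := by
            refine add_le_add hε1 ?_
            rw [intervalIntegral.integral_of_le hε]
            exact setIntegral_le_integral h2 (ae_of_all _ fun s => by positivity)
        _ = 1 + ∫ x : ℝ, ‖f x‖ ^ 2 := by
            congr 1
            simpa using integral_add_left_eq_self (fun s : ℝ => ‖f s‖ ^ 2) x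
    -- Taking (1+|x|)⁻¹ in the role of `κ` gives the weighted integrability of the average.
    · have h1 := (integrable_shift_mul hfc hf2 hκi (N := 1) (fun x => by
        rw [Complex.norm_real, Real.norm_of_nonneg (by positivity),
          inv_mul_cancel₀ (by positivity)])
        ε).integral_prod_left.norm
      refine h1.congr (ae_of_all _ fun x => ?_)
      simp only
      rw [integral_mul_const, norm_mul, Complex.norm_real, Real.norm_of_nonneg (by positivity),
        intervalIntegral.integral_of_le hε, div_eq_mul_inv]
  have hq : Continuous fun s : ℝ => f (w + s) - ψ s := by fun_prop
  have hder : HasDerivAt (fun ε => ∫ s in (0 : ℝ)..ε, (f (w + s) - ψ s))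
      (f (w + (0 : ℝ)) - ψ 0) 0 :=
    intervalIntegral.integral_hasDerivAt_right (by simp)
      (hq.stronglyMeasurableAtFilter _ _) hq.continuousAt
  -- The integral is known to vanish only for ε ∈ [0, 1], so a one-sided derivative at 0 is
  -- compared.
  have hder0 : HasDerivWithinAt (fun ε => ∫ s in (0 : ℝ)..ε, (f (w + s) - ψ s)) 0
      (Set.Icc (0 : ℝ) 1) 0 := by
    refine (hasDerivWithinAt_const (0 : ℝ) (Set.Icc (0 : ℝ) 1) (0 : ℂ)).congr hmain
      (hmain 0 (by simp))
  have := (uniqueDiffOn_Icc_zero_one 0 (by simp)).eq_deriv _ hder.hasDerivWithinAt hder0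
  rw [sub_eq_zero] at this
  simpa [hψ] using this

/-! ### Transforms of exponentials on intervals -/

/-- `k` belongs to the space and reproduces its elements at `w`. -/
def ReproducesAt (Δ : ℝ) (w : ℂ) (k : ℂ → ℂ) : Prop :=
  k ∈ space Δ ∧ ∀ f ∈ space Δ, f w = innerW f k

/-- `k` is of exponential type `2πL` and decays like `1 / |x|` on the real line, with
constant `N`. -/
structure HasDecay (L N : ℝ) (k : ℂ → ℂ) : Prop where
  growth : ∀ z, ‖k z‖ ≤ N * Real.exp (2 * π * L * ‖z‖)
  decay : ∀ x : ℝ, ‖k x‖ * (1 + |x|) ≤ N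

lemma HasDecay.add {L M N : ℝ} {k l : ℂ → ℂ} (hk : HasDecay L M k) (hl : HasDecay L N l) :
    HasDecay L (M + N) fun z => k z + l z := by
  constructor
  · intro z
    rw [add_mul]
    exact (norm_add_le _ _).trans (add_le_add (hk.growth z) (hl.growth z))
  · intro x
    calc _ ≤ (‖k x‖ + ‖l x‖) * (1 + |x|) := by gcongr; exact norm_add_le _ _
      _ ≤ _ := by rw [add_mul]; exact add_le_add (hk.decay x) (hl.decay x)

lemma HasDecay.const_mul {L N : ℝ} {k : ℂ → ℂ} (hk : HasDecay L N k) (c : ℂ) :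
    HasDecay L (‖c‖ * N) fun z => c * k z := by
  constructor
  · intro z
    rw [norm_mul, mul_assoc]
    exact mul_le_mul_of_nonneg_left (hk.growth z) (norm_nonneg _)
  · intro x
    rw [norm_mul, mul_assoc]
    exact mul_le_mul_of_nonneg_left (hk.decay x) (norm_nonneg _)

lemma HasDecay.mono {L M N : ℝ} {k : ℂ → ℂ} (hk : HasDecay L M k) (h : M ≤ N) :
    HasDecay L N k :=
  ⟨fun z => (hk.growth z).trans (by gcongr), fun x => (hk.decay x).trans h⟩

lemma HasDecay.mem_space {L N : ℝ} (hL : 0 < L) {k : ℂ → ℂ} (hd : Differentiable ℂ k)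
    (hk : HasDecay L N k) : k ∈ space (2 * L) := by
  rw [mem_space_iff (by positivity)]
  have hc := hd.continuous
  refine ⟨hd, HasGrowth.of_bound (M := N) fun z => ?_, ?_⟩
  · rw [show π * (2 * L) * ‖z‖ = 2 * π * L * ‖z‖ by ring]
    exact hk.growth z
  · refine (integrable_inv_one_add_sq.const_mul (N ^ 2)).mono'
      (Continuous.aestronglyMeasurable (by fun_prop)) (ae_of_all _ fun x => ?_)
    rw [Real.norm_of_nonneg (by positivity), ← div_eq_mul_inv, le_div_iff₀ (by positivity)]
    have h3 : (‖k x‖ * (1 + |x|)) ^ 2 ≤ N ^ 2 := by gcongr; exact hk.decay x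
    refine le_trans ?_ h3
    rw [mul_pow]
    gcongr
    nlinarith [abs_nonneg x, sq_abs x]

/-- The entire function `s ↦ ∫_α^β exp (st) dt`. -/
def expInt (α β : ℝ) (s : ℂ) : ℂ := ∫ t in α..β, exp (s * t)

lemma differentiable_expInt (α β : ℝ) : Differentiable ℂ (expInt α β) := by
  refine differentiable_intervalIntegral (g := fun s t => exp (s * t)) ?_ ?_ _ _
  · simp only [Function.uncurry_def]; fun_prop
  · intro t; fun_prop

lemma continuous_expInt (α β : ℝ) : Continuous (expInt α β) :=
  (differentiable_expInt α β).continuous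

/-- In this division-free form the identity needs no condition on `s`, so removable singularities
never have to be treated separately. -/
lemma mul_expInt (α β : ℝ) (s : ℂ) : s * expInt α β s = exp (s * β) - exp (s * α) := by
  by_cases hs : s = 0
  · simp [hs]
  · rw [expInt, integral_exp_mul_complex hs, mul_div_cancel₀ _ hs]

lemma expInt_eq_div (α β : ℝ) {s : ℂ} (hs : s ≠ 0) :
    expInt α β s = (exp (s * β) - exp (s * α)) / s := by
  rw [← mul_expInt, mul_div_cancel_left₀ _ hs]

lemma sinQuot_eq_expInt (c : ℝ) (u : ℂ) :
    sinQuot c u = expInt (-(c / 2)) (c / 2) (2 * π * I * u) := by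
  unfold sinQuot
  split_ifs with hu
  · simp [expInt, hu]
  · have hp : (π : ℂ) ≠ 0 := by exact_mod_cast Real.pi_ne_zero
    have hI := I_ne_zero
    rw [expInt_eq_div _ _ (by simp [hu, Real.pi_ne_zero]), Complex.sin]
    push_cast
    rw [show 2 * (π : ℂ) * I * u * (c / 2) = π * c * u * I by ring,
      show 2 * (π : ℂ) * I * u * -(c / 2) = -(π * c * u) * I by ring]
    field_simp
    linear_combination (exp (-(π * c * u * I : ℂ)) - exp (π * c * u * I : ℂ)) * I_sq

lemma norm_expInt_le {α β L : ℝ} (hα : |α| ≤ L) (hβ : |β| ≤ L) {s : ℂ} {r : ℝ}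
    (hs : |s.re| ≤ r) : ‖expInt α β s‖ ≤ 2 * L * Real.exp (r * L) := by
  have hL : 0 ≤ L := (abs_nonneg _).trans hα
  have h : ‖expInt α β s‖ ≤ Real.exp (r * L) * |β - α| := by
    refine intervalIntegral.norm_integral_le_of_norm_le_const fun t ht => ?_
    have htL : |t| ≤ L := by
      have h1 := Set.uIoc_subset_uIcc ht
      have h2 : t ∈ Set.Icc (-L) L :=
        (Set.ordConnected_Icc.uIcc_subset (abs_le.1 hα) (abs_le.1 hβ)) h1
      exact abs_le.2 h2
    rw [Complex.norm_exp]
    gcongr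
    rw [Complex.re_mul_ofReal]
    refine (le_abs_self _).trans ?_
    rw [abs_mul]
    gcongr
    exact (abs_nonneg _).trans hs
  refine h.trans ?_
  rw [mul_comm]
  gcongr
  calc |β - α| ≤ |β| + |α| := abs_sub _ _
    _ ≤ 2 * L := by linarith

/-- On ℝ the real part of the argument is that of `c`, so the integral is bounded, and so is its
product with `s` by `mul_expInt`; together they give decay 1/|x|. The constant depends on `c` only
through `R`. -/
lemma hasDecay_expInt {α β L R : ℝ} (hα : |α| ≤ L) (hβ : |β| ≤ L) {c : ℂ} (hc : ‖c‖ ≤ R) :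
    HasDecay L ((1 + R) * (2 * L + 2) * Real.exp (R * L))
      fun z => expInt α β (2 * π * I * z + c) := by
  have hL : 0 ≤ L := (abs_nonneg _).trans hα
  have hR : 0 ≤ R := (norm_nonneg _).trans hc
  constructor
  · intro z
    have h1 : |(2 * π * I * z + c).re| ≤ 2 * π * ‖z‖ + R := by
      refine (Complex.abs_re_le_norm _).trans ((norm_add_le _ _).trans (add_le_add ?_ hc))
      rw [norm_mul, norm_mul, norm_mul, norm_I, Complex.norm_real,
        Real.norm_of_nonneg Real.pi_pos.le]
      simp
    refine (norm_expInt_le hα hβ h1).trans ?_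
    rw [add_mul, Real.exp_add]
    have h2 : 2 * L ≤ (1 + R) * (2 * L + 2) := by nlinarith [mul_nonneg hR hL]
    calc 2 * L * (Real.exp (2 * π * ‖z‖ * L) * Real.exp (R * L))
        = 2 * L * Real.exp (R * L) * Real.exp (2 * π * L * ‖z‖) := by
          rw [show 2 * π * ‖z‖ * L = 2 * π * L * ‖z‖ by ring]; ring
      _ ≤ _ := by gcongr
  · intro x
    set s : ℂ := 2 * π * I * x + c with hs
    have hre : |s.re| ≤ R := by
      have : s.re = c.re := by simp [hs]
      rw [this]
      exact (Complex.abs_re_le_norm _).trans hc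
    have h1 := norm_expInt_le hα hβ hre
    have he : ∀ γ : ℝ, |γ| ≤ L → ‖exp (s * γ)‖ ≤ Real.exp (R * L) := fun γ hγ => by
      rw [Complex.norm_exp, Complex.re_mul_ofReal]
      refine Real.exp_le_exp.2 ((le_abs_self _).trans ?_)
      rw [abs_mul]
      exact mul_le_mul hre hγ (abs_nonneg _) hR
    have h2 : ‖s‖ * ‖expInt α β s‖ ≤ 2 * Real.exp (R * L) := by
      rw [← norm_mul, mul_expInt]
      refine (norm_sub_le _ _).trans ?_
      linarith [he β hβ, he α hα]
    have h3 : |x| ≤ ‖s‖ + R := by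
      have h4 : ‖(2 * π * I * x : ℂ)‖ ≤ ‖s‖ + R := by
        rw [show (2 * π * I * x : ℂ) = s - c by rw [hs]; ring]
        exact (norm_sub_le _ _).trans (by gcongr)
      rw [norm_mul, norm_mul, norm_mul, norm_I, Complex.norm_real, Complex.norm_real,
        Real.norm_of_nonneg Real.pi_pos.le, Real.norm_eq_abs] at h4
      simp at h4
      nlinarith [Real.pi_gt_three, abs_nonneg x]
    have h5 : 1 + |x| ≤ (1 + R) * (1 + ‖s‖) := by nlinarith [mul_nonneg hR (norm_nonneg s)]
    calc _ ≤ ‖expInt α β s‖ * ((1 + R) * (1 + ‖s‖)) := by gcongr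
      _ = (1 + R) * (‖expInt α β s‖ + ‖s‖ * ‖expInt α β s‖) := by ring
      _ ≤ (1 + R) * (2 * L * Real.exp (R * L) + 2 * Real.exp (R * L)) := by gcongr
      _ = _ := by ring

lemma intervalIntegral_indicator_Ioc (g : ℝ → ℂ) {c d α β α' β' : ℝ} (hcd : c ≤ d)
    (h1 : max c α = α') (h2 : min d β = β') (h3 : α' ≤ β') :
    ∫ t in c..d, Set.indicator (Set.Ioc α β) g t = ∫ t in α'..β', g t := by
  rw [intervalIntegral.integral_of_le hcd, intervalIntegral.integral_of_le h3,
    setIntegral_indicator measurableSet_Ioc, Set.Ioc_inter_Ioc]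
  subst h1 h2
  rfl

lemma integrable_indicator_Ioc {g : ℝ → ℂ} (hg : Continuous g) (α β : ℝ) :
    Integrable (Set.indicator (Set.Ioc α β) g) :=
  (hg.integrableOn_Ioc).integrable_indicator measurableSet_Ioc

lemma integral_indicator_exp_mul (α β : ℝ) (h : α ≤ β) (c z : ℂ) :
    ∫ t, Set.indicator (Set.Ioc α β) (fun t : ℝ => exp (c * t)) t * exp (2 * π * I * t * z)
      = expInt α β (2 * π * I * z + c) := by
  have : (fun t : ℝ => Set.indicator (Set.Ioc α β) (fun t : ℝ => exp (c * t)) t *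
      exp (2 * π * I * t * z))
      = Set.indicator (Set.Ioc α β) fun t : ℝ => exp ((2 * π * I * z + c) * t) := by
    ext t
    simp only [Set.indicator_apply]
    split_ifs
    · rw [← Complex.exp_add]; congr 1; ring
    · simp
  rw [this, integral_indicator measurableSet_Ioc, expInt, intervalIntegral.integral_of_le h]

/-- `k` is the Fourier transform of the integrable function `h`, entire, of exponential type `2πL`,
and decays like `1 / |x|` on the real line, with constant `N`. -/
structure IsTransform (L N : ℝ) (h : ℝ → ℂ) (k : ℂ → ℂ) : Prop where
  differentiable : Differentiable ℂ k
  hasDecay : HasDecay L N k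
  integrable : Integrable h
  repr : ∀ x : ℝ, k x = ∫ t, h t * exp (2 * π * I * t * x)

lemma IsTransform.integrable_mul {L N : ℝ} {h : ℝ → ℂ} {k : ℂ → ℂ} (hk : IsTransform L N h k)
    (x : ℝ) : Integrable fun t : ℝ => h t * exp (2 * π * I * t * x) := by
  refine hk.integrable.norm.mono' (hk.integrable.aestronglyMeasurable.mul
    (Continuous.aestronglyMeasurable (by fun_prop))) (ae_of_all _ fun t => ?_)
  rw [norm_mul, norm_exp_two_pi_mul, mul_one]

lemma IsTransform.add {L M N : ℝ} {h h₂ : ℝ → ℂ} {k k₂ : ℂ → ℂ} (hk : IsTransform L M h k)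
    (hk₂ : IsTransform L N h₂ k₂) :
    IsTransform L (M + N) (fun t => h t + h₂ t) fun z => k z + k₂ z := by
  refine ⟨hk.1.add hk₂.1, hk.2.add hk₂.2, hk.3.add hk₂.3, fun x => ?_⟩
  simp only [add_mul]
  rw [integral_add (hk.integrable_mul x) (hk₂.integrable_mul x), ← hk.repr, ← hk₂.repr]

lemma IsTransform.const_mul {L N : ℝ} {h : ℝ → ℂ} {k : ℂ → ℂ} (hk : IsTransform L N h k) (c : ℂ) :
    IsTransform L (‖c‖ * N) (fun t => c * h t) fun z => c * k z := by
  refine ⟨hk.1.const_mul c, hk.2.const_mul c, hk.3.const_mul c, fun x => ?_⟩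
  simp only [mul_assoc c]
  rw [integral_const_mul, ← hk.repr]

lemma isTransform_expInt {α β L R : ℝ} (hα : |α| ≤ L) (hβ : |β| ≤ L) (h : α ≤ β) {c : ℂ}
    (hc : ‖c‖ ≤ R) :
    IsTransform L ((1 + R) * (2 * L + 2) * Real.exp (R * L))
      (Set.indicator (Set.Ioc α β) fun t : ℝ => exp (c * t))
      fun z => expInt α β (2 * π * I * z + c) :=
  ⟨(differentiable_expInt α β).comp (by fun_prop), hasDecay_expInt hα hβ hc,
    integrable_indicator_Ioc (by fun_prop) α β,
    fun x => (integral_indicator_exp_mul α β h c x).symm⟩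

/-- The function conj(k)·W decays like 1/|x| with constant 2N, so the formula for quadratically
decaying functions extends to the whole space by `repr_of_square_integrable`. -/
lemma reproducesAt_of_integral_equation {L N : ℝ} (hL : 0 < L) {w : ℂ} {h : ℝ → ℂ} {k : ℂ → ℂ}
    (hk : IsTransform L N h k)
    (heq : ∀ s ∈ Set.Ioc (-L) L,
      h s + 1 / 2 * ∫ t in (s - 1)..(s + 1), h t = exp (-2 * π * I * conj w * s)) :
    ReproducesAt (2 * L) w k := by
  have hd := hk.differentiable
  have hkd := hk.hasDecay
  refine ⟨hkd.mem_space hL hd, fun f hf => ?_⟩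
  obtain ⟨f1, f2, f3⟩ := (mem_space_iff (by positivity)).1 hf
  have hWc := continuous_W
  have hkc := hd.continuous
  have hconj := Complex.continuous_conj
  have := repr_of_square_integrable (σ := π * (2 * L)) (N := N * 2) (w := w)
    (κ := fun x : ℝ => conj (k x) * (W x : ℂ)) (by positivity)
    (by fun_prop) (fun x => ?_) (fun g g1 g2 ⟨M, hM⟩ => ?_) f1 f2 f3
  · rw [this, innerW]
    congr 1; ext x; ring
  · rw [norm_mul, RCLike.norm_conj, Complex.norm_real, Real.norm_of_nonneg (W_pos x).le]
    have h1 := hkd.decay x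
    have h2 := W_le_two x
    calc _ = ‖k x‖ * (1 + |x|) * W x := by ring
      _ ≤ N * 2 := mul_le_mul h1 h2 (W_pos x).le (le_trans (by positivity) h1)
  · rw [reproduces_of_integral_equation hL g1
      (by rwa [show 2 * π * L = π * (2 * L) by ring]) hM hk.integrable hk.repr heq, innerW]
    congr 1; ext x; ring

/-! ### The kernel for Δ ≤ 1 -/

/-- The kernel for `Δ = 2L ≤ 1`. -/
lemma reproducesAt_kernelSmall {L : ℝ} (hL : 0 < L) (hL1 : 2 * L ≤ 1) (w : ℂ) :
    ReproducesAt (2 * L) w (kernelSmall (2 * L) w) := by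
  set ζ := conj w with hζ
  set c₀ : ℂ := -(1 / (2 + (2 * L : ℝ)) * sinQuot (2 * L) ζ) with hc₀
  have hk : kernelSmall (2 * L) w = fun z => expInt (-L) L (2 * π * I * z + -2 * π * I * ζ) +
      c₀ * expInt (-L) L (2 * π * I * z + 0) := by
    ext z
    rw [kernelSmall, sinQuot_eq_expInt _ (z - conj w), sinQuot_eq_expInt _ z, ← hζ, hc₀,
      show 2 * L / 2 = L by ring, add_zero,
      show 2 * (π : ℂ) * I * (z - ζ) = 2 * π * I * z + -2 * π * I * ζ by ring]
    ring
  have hα : |(-L)| ≤ L := by rw [abs_neg, abs_of_pos hL]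
  have hβ : |L| ≤ L := (abs_of_pos hL).le
  have hL' : -L ≤ L := by linarith
  set h : ℝ → ℂ := fun t => Set.indicator (Set.Ioc (-L) L) (fun t : ℝ => exp (-2 * π * I * ζ * t)) t
    + c₀ * Set.indicator (Set.Ioc (-L) L) (fun t : ℝ => exp (0 * t)) t with hh
  have hi1 := integrable_indicator_Ioc (g := fun t : ℝ => exp (-2 * π * I * ζ * t))
    (by fun_prop) (-L) L
  have hi2 := integrable_indicator_Ioc (g := fun t : ℝ => exp (0 * (t : ℂ))) (by fun_prop) (-L) L
  rw [hk]
  refine reproducesAt_of_integral_equation hL (h := h)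
    ((isTransform_expInt hα hβ hL' le_rfl).add ((isTransform_expInt hα hβ hL' le_rfl).const_mul c₀))
    fun s hs => ?_
  -- As 2L ≤ 1, the window contains all of (-L, L]. The integral equation reduces to c₀ + ½(sinQuot
  -- ζ + 2L c₀) = 0, which is the origin of `c₀`.
  · have h1 : ∫ t in (s - 1)..(s + 1), h t = sinQuot (2 * L) ζ + c₀ * (2 * L) := by
      simp only [hh]
      have hm1 : max (s - 1) (-L) = -L := max_eq_right (by linarith [hs.2])
      have hm2 : min (s + 1) L = L := min_eq_right (by linarith [hs.1])
      rw [intervalIntegral.integral_add hi1.intervalIntegrable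
        (hi2.intervalIntegrable.const_mul c₀), intervalIntegral.integral_const_mul,
        intervalIntegral_indicator_Ioc _ (by linarith) hm1 hm2 (by linarith),
        intervalIntegral_indicator_Ioc _ (by linarith) hm1 hm2 (by linarith)]
      congr 1
      · have : sinQuot (2 * L) ζ = sinQuot (2 * L) (-ζ) := by
          unfold sinQuot; simp
        rw [this, sinQuot_eq_expInt, expInt, show 2 * L / 2 = L by ring]
        congr 1; ext t; congr 1; ring
      · simp; left; ring
    have hden : (2 + (2 * L : ℝ) : ℂ) ≠ 0 := by
      have : (2 + 2 * L : ℝ) ≠ 0 := by positivity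
      exact_mod_cast this
    have hc : c₀ * (2 + 2 * L) = -sinQuot (2 * L) ζ := by
      rw [hc₀]
      push_cast at hden ⊢
      rw [← neg_mul, mul_right_comm, neg_mul, one_div, inv_mul_cancel₀ hden]
      ring
    rw [h1]
    simp only [hh, Set.indicator_of_mem hs, zero_mul, Complex.exp_zero]
    linear_combination 1 / 2 * hc

/-! ### The integral equation for 1 < Δ ≤ 2 -/

/-- The solution on `(-L, L-1]`, `(L-1, 1-L]`, `(1-L, L]` of the integral equation for
`1/2 < L ≤ 1`, with free coefficients. -/
def solLeft (α β c' ζ : ℂ) (t : ℝ) : ℂ :=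
  α * exp (I / 2 * t) + β * exp (-(I / 2) * t) + c' * exp (-2 * π * I * ζ * t)

/-- The middle part of the solution, see `solLeft`. -/
def solMid (δ ζ : ℂ) (t : ℝ) : ℂ := δ * exp (0 * t) + exp (-2 * π * I * ζ * t)

/-- The right part of the solution, see `solLeft`. -/
def solRight (α β c ζ : ℂ) (t : ℝ) : ℂ :=
  -- The coefficients of e^{±it/2} are forced by the homogeneous equation h_l'(s) = -½h_r(s+1)
  -- applied to the same terms of `solLeft`.
  -I * exp (-(I / 2)) * α * exp (I / 2 * t) + I * exp (I / 2) * β * exp (-(I / 2) * t)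
    + c * exp (-2 * π * I * ζ * t)

/-- The kernel whose Fourier transform is composed of `solLeft`, `solMid` and `solRight`. -/
def kernelAux (L : ℝ) (α β c c' δ ζ z : ℂ) : ℂ :=
  (α * expInt (-L) (L - 1) (2 * π * I * z + I / 2)
      + β * expInt (-L) (L - 1) (2 * π * I * z + -(I / 2))
      + c' * expInt (-L) (L - 1) (2 * π * I * z + -2 * π * I * ζ))
    + (δ * expInt (L - 1) (1 - L) (2 * π * I * z + 0)
      + expInt (L - 1) (1 - L) (2 * π * I * z + -2 * π * I * ζ))
    + (-I * exp (-(I / 2)) * α * expInt (1 - L) L (2 * π * I * z + I / 2)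
      + I * exp (I / 2) * β * expInt (1 - L) L (2 * π * I * z + -(I / 2))
      + c * expInt (1 - L) L (2 * π * I * z + -2 * π * I * ζ))

lemma expInt_mul_eq (x y : ℝ) (s c d : ℂ) (h : c = d * s) :
    c * expInt x y s = d * (exp (s * y) - exp (s * x)) := by
  rw [h, mul_assoc, mul_expInt]

/-- The delay equation in integrated form: `solRight` is -2 times the derivative of `solLeft` minus
the forcing exponential, shifted by 1. `hc` is this relation for the terms in exp(-2πiζt). -/
lemma integral_solRight {α β c c' ζ : ℂ}
    (hc : c = 4 * π * I * ζ * (c' - 1) * exp (2 * π * I * ζ)) (x y : ℝ) :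
    ∫ t in x..y, solRight α β c ζ t =
      -2 * ((solLeft α β c' ζ (y - 1) - exp (-2 * π * I * ζ * (y - 1 : ℝ)))
        - (solLeft α β c' ζ (x - 1) - exp (-2 * π * I * ζ * (x - 1 : ℝ)))) := by
  have h1 : ∫ t in x..y, solRight α β c ζ t =
      -I * exp (-(I / 2)) * α * expInt x y (I / 2) + I * exp (I / 2) * β * expInt x y (-(I / 2))
        + c * expInt x y (-2 * π * I * ζ) := by
    simp only [solRight, expInt]
    rw [intervalIntegral.integral_add, intervalIntegral.integral_add,
      intervalIntegral.integral_const_mul, intervalIntegral.integral_const_mul,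
      intervalIntegral.integral_const_mul]
    all_goals exact Continuous.intervalIntegrable (by fun_prop) _ _
  have hs : ∀ (s : ℂ) (r : ℝ), exp (s * (r - 1 : ℝ)) = exp (-s) * exp (s * r) := fun s r => by
    rw [← Complex.exp_add]; congr 1; push_cast; ring
  rw [h1, expInt_mul_eq x y (I / 2) _ (-2 * exp (-(I / 2)) * α) (by ring),
    expInt_mul_eq x y (-(I / 2)) _ (-2 * exp (I / 2) * β) (by ring),
    expInt_mul_eq x y (-2 * π * I * ζ) c (-2 * (c' - 1) * exp (2 * π * I * ζ)) (by rw [hc]; ring)]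
  simp only [solLeft, hs, neg_neg]
  rw [show -(-2 * π * I * ζ) = 2 * π * I * ζ by ring]
  ring

/-- The companion of `integral_solRight`, with opposite sign and shift: here the lower end of the
window has left the support, or the upper end, is what decides the sign. -/
lemma integral_solLeft {α β c c' ζ : ℂ}
    (hc : c' = -4 * π * I * ζ * (c - 1) * exp (-2 * π * I * ζ)) (x y : ℝ) :
    ∫ t in x..y, solLeft α β c' ζ t =
      2 * ((solRight α β c ζ (y + 1) - exp (-2 * π * I * ζ * (y + 1 : ℝ)))
        - (solRight α β c ζ (x + 1) - exp (-2 * π * I * ζ * (x + 1 : ℝ)))) := by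
  have h1 : ∫ t in x..y, solLeft α β c' ζ t =
      α * expInt x y (I / 2) + β * expInt x y (-(I / 2)) + c' * expInt x y (-2 * π * I * ζ) := by
    simp only [solLeft, expInt]
    rw [intervalIntegral.integral_add, intervalIntegral.integral_add,
      intervalIntegral.integral_const_mul, intervalIntegral.integral_const_mul,
      intervalIntegral.integral_const_mul]
    all_goals exact Continuous.intervalIntegrable (by fun_prop) _ _
  have hs : ∀ (s : ℂ) (r : ℝ), exp (s * (r + 1 : ℝ)) = exp s * exp (s * r) := fun s r => by
    rw [← Complex.exp_add]; congr 1; push_cast; ring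
  have he : exp (-(I / 2)) * exp (I / 2) = 1 := by rw [← Complex.exp_add]; simp
  rw [h1, expInt_mul_eq x y (I / 2) _ (-2 * I * α) (by linear_combination α * I_sq),
    expInt_mul_eq x y (-(I / 2)) _ (2 * I * β) (by linear_combination β * I_sq),
    expInt_mul_eq x y (-2 * π * I * ζ) c' (2 * (c - 1) * exp (-2 * π * I * ζ)) (by rw [hc]; ring)]
  simp only [solRight, hs]
  linear_combination (2 * I * α * (exp (I / 2 * y) - exp (I / 2 * x))
    - 2 * I * β * (exp (-(I / 2) * y) - exp (-(I / 2) * x))) * he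

lemma integral_solMid (L : ℝ) (δ ζ : ℂ) :
    ∫ t in (L - 1)..(1 - L), solMid δ ζ t = δ * (2 - 2 * L) + sinQuot (2 - 2 * L) ζ := by
  have : sinQuot (2 - 2 * L) ζ = sinQuot (2 - 2 * L) (-ζ) := by
    unfold sinQuot; simp
  simp only [solMid]
  rw [intervalIntegral.integral_add, this, sinQuot_eq_expInt, expInt]
  · congr 1
    · simp; ring
    · rw [show -((2 - 2 * L) / 2) = L - 1 by ring, show (2 - 2 * L) / 2 = 1 - L by ring]
      congr 1; ext t; congr 1; ring
  all_goals exact Continuous.intervalIntegrable (by fun_prop) _ _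

/-- A bound for the decay constant of `kernelAux`. -/
def boundAux (L : ℝ) (α β c c' δ ζ : ℂ) : ℝ :=
  (2 * ‖α‖ + 2 * ‖β‖ + ‖c‖ + ‖c'‖ + ‖δ‖ + 1) *
    ((1 + (1 + 2 * π * ‖ζ‖)) * (2 * L + 2) * Real.exp ((1 + 2 * π * ‖ζ‖) * L))

lemma isTransform_kernelAux {L : ℝ} (hL : 1 / 2 < L) (hL1 : L ≤ 1) (α β c c' δ ζ : ℂ) :
    IsTransform L (boundAux L α β c c' δ ζ)
      (fun t => Set.indicator (Set.Ioc (-L) (L - 1)) (solLeft α β c' ζ) t +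
        Set.indicator (Set.Ioc (L - 1) (1 - L)) (solMid δ ζ) t +
        Set.indicator (Set.Ioc (1 - L) L) (solRight α β c ζ) t)
      (kernelAux L α β c c' δ ζ) := by
  have b1 : |(-L)| ≤ L := by rw [abs_neg, abs_of_pos (by linarith)]
  have b2 : |L - 1| ≤ L := abs_le.2 ⟨by linarith, by linarith⟩
  have b3 : |1 - L| ≤ L := abs_le.2 ⟨by linarith, by linarith⟩
  have b4 : |L| ≤ L := (abs_of_pos (by linarith)).le
  have o1 : -L ≤ L - 1 := by linarith
  have o2 : L - 1 ≤ 1 - L := by linarith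
  have o3 : 1 - L ≤ L := by linarith
  set R : ℝ := 1 + 2 * π * ‖ζ‖ with hR
  have hp := Real.pi_pos
  have r1 : ‖I / 2‖ ≤ R := by
    have : ‖I / 2‖ = 1 / 2 := by simp
    rw [this, hR]
    have : 0 ≤ 2 * π * ‖ζ‖ := by positivity
    linarith
  have r2 : ‖-(I / 2)‖ ≤ R := by rwa [norm_neg]
  have r3 : ‖-2 * π * I * ζ‖ ≤ R := by
    have : ‖-2 * π * I * ζ‖ = 2 * π * ‖ζ‖ := by
      rw [norm_mul, norm_mul, norm_mul, norm_I, Complex.norm_real, Real.norm_of_nonneg hp.le]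
      simp
    rw [this, hR]; linarith
  have r4 : ‖(0 : ℂ)‖ ≤ R := by rw [norm_zero, hR]; positivity
  have T := ((((isTransform_expInt b1 b2 o1 r1).const_mul α).add
    ((isTransform_expInt b1 b2 o1 r2).const_mul β)).add
    ((isTransform_expInt b1 b2 o1 r3).const_mul c')).add
    (((isTransform_expInt b2 b3 o2 r4).const_mul δ).add (isTransform_expInt b2 b3 o2 r3)) |>.add
    ((((isTransform_expInt b3 b4 o3 r1).const_mul (-I * exp (-(I / 2)) * α)).add
    ((isTransform_expInt b3 b4 o3 r2).const_mul (I * exp (I / 2) * β))).add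
    ((isTransform_expInt b3 b4 o3 r3).const_mul c))
  convert T using 1
  · have e1 : ‖-I * exp (-(I / 2)) * α‖ = ‖α‖ := by
      rw [norm_mul, norm_mul, norm_neg, norm_I, Complex.norm_exp]; simp
    have e2 : ‖I * exp (I / 2) * β‖ = ‖β‖ := by
      rw [norm_mul, norm_mul, norm_I, Complex.norm_exp]; simp
    rw [e1, e2, boundAux, ← hR]
    ring
  · ext t
    simp only [Set.indicator_apply, solLeft, solMid, solRight]
    split_ifs <;> ring
  · rfl

/-- `hc` and `hc'` make the integral equation hold up to a constant on each outer interval. `hr` and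
`hl` say that `h` minus the forcing exponential takes the value `δ` at both junctions ±(1-L), and
`hm` is then the equation on the middle interval; the outer equations follow. -/
lemma reproducesAt_kernelAux {L : ℝ} (hL : 1 / 2 < L) (hL1 : L ≤ 1) {α β c c' δ w ζ : ℂ}
    (hζ : ζ = conj w)
    (hc : c = 4 * π * I * ζ * (c' - 1) * exp (2 * π * I * ζ))
    (hc' : c' = -4 * π * I * ζ * (c - 1) * exp (-2 * π * I * ζ))
    (hr : solRight α β c ζ (1 - L) - exp (-2 * π * I * ζ * (1 - L : ℝ)) = δ)
    (hl : solLeft α β c' ζ (L - 1) - exp (-2 * π * I * ζ * (L - 1 : ℝ)) = δ)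
    (hm : (solRight α β c ζ L - exp (-2 * π * I * ζ * L))
      + (solLeft α β c' ζ (-L) - exp (-2 * π * I * ζ * (-L : ℝ)))
      + 1 / 2 * (δ * (2 - 2 * L) + sinQuot (2 - 2 * L) ζ) = δ) :
    ReproducesAt (2 * L) w (kernelAux L α β c c' δ ζ) := by
  refine reproducesAt_of_integral_equation (by linarith)
    (isTransform_kernelAux hL hL1 α β c c' δ ζ) fun s hs => ?_
  rw [← hζ]
  have i1 := integrable_indicator_Ioc (g := solLeft α β c' ζ) (by unfold solLeft; fun_prop)
    (-L) (L - 1)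
  have i2 := integrable_indicator_Ioc (g := solMid δ ζ) (by unfold solMid; fun_prop)
    (L - 1) (1 - L)
  have i3 := integrable_indicator_Ioc (g := solRight α β c ζ) (by unfold solRight; fun_prop)
    (1 - L) L
  have i12 : Integrable fun t => Set.indicator (Set.Ioc (-L) (L - 1)) (solLeft α β c' ζ) t +
      Set.indicator (Set.Ioc (L - 1) (1 - L)) (solMid δ ζ) t := i1.add i2
  rw [intervalIntegral.integral_add i12.intervalIntegrable i3.intervalIntegrable,
    intervalIntegral.integral_add i1.intervalIntegrable i2.intervalIntegrable]
  obtain ⟨hs1, hs2⟩ := hs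
  have hI3 := integral_solRight (α := α) (β := β) hc
  have hI1 := integral_solLeft (α := α) (β := β) hc'
  have hs0 : s - 1 ≤ s + 1 := by linarith
  have e1 : L - 1 + 1 = L := by ring
  have e2 : -L + 1 = 1 - L := by ring
  have e3 : 1 - L - 1 = -L := by ring
  rcases le_or_gt s (L - 1) with h1 | h1
  · rw [intervalIntegral_indicator_Ioc _ hs0 (α' := -L) (β' := L - 1)
        (max_eq_right (by linarith)) (min_eq_right (by linarith)) (by linarith),
      intervalIntegral_indicator_Ioc _ hs0 (α' := L - 1) (β' := 1 - L)
        (max_eq_right (by linarith)) (min_eq_right (by linarith)) (by linarith),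
      intervalIntegral_indicator_Ioc _ hs0 (α' := 1 - L) (β' := s + 1)
        (max_eq_right (by linarith)) (min_eq_left (by linarith)) (by linarith),
      Set.indicator_of_mem (Set.mem_Ioc.2 ⟨hs1, h1⟩),
      Set.indicator_of_notMem (fun h => by linarith [h.1]),
      Set.indicator_of_notMem (fun h => by linarith [h.1]), hI1, hI3, integral_solMid, e1, e2, e3,
      add_sub_cancel_right]
    linear_combination hm - hr
  rcases le_or_gt s (1 - L) with h2 | h2
  · rw [intervalIntegral_indicator_Ioc _ hs0 (α' := -L) (β' := L - 1)
        (max_eq_right (by linarith)) (min_eq_right (by linarith)) (by linarith),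
      intervalIntegral_indicator_Ioc _ hs0 (α' := L - 1) (β' := 1 - L)
        (max_eq_right (by linarith)) (min_eq_right (by linarith)) (by linarith),
      intervalIntegral_indicator_Ioc _ hs0 (α' := 1 - L) (β' := L)
        (max_eq_right (by linarith)) (min_eq_right (by linarith)) (by linarith),
      Set.indicator_of_notMem (fun h => by linarith [h.2]),
      Set.indicator_of_mem (Set.mem_Ioc.2 ⟨h1, h2⟩),
      Set.indicator_of_notMem (fun h => by linarith [h.1]), hI1, hI3, integral_solMid, e1, e2, e3]
    simp only [solMid, zero_mul, Complex.exp_zero]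
    linear_combination hm - hr - hl
  · rw [intervalIntegral_indicator_Ioc _ hs0 (α' := s - 1) (β' := L - 1)
        (max_eq_left (by linarith)) (min_eq_right (by linarith)) (by linarith),
      intervalIntegral_indicator_Ioc _ hs0 (α' := L - 1) (β' := 1 - L)
        (max_eq_right (by linarith)) (min_eq_right (by linarith)) (by linarith),
      intervalIntegral_indicator_Ioc _ hs0 (α' := 1 - L) (β' := L)
        (max_eq_right (by linarith)) (min_eq_right (by linarith)) (by linarith),
      Set.indicator_of_notMem (fun h => by linarith [h.2]),
      Set.indicator_of_notMem (fun h => by linarith [h.2]),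
      Set.indicator_of_mem (Set.mem_Ioc.2 ⟨h2, hs2⟩), hI1, hI3, integral_solMid, e1, e3,
      sub_add_cancel]
    linear_combination hm - hl

/-! ### Determinant, coefficients and junction conditions -/

lemma conj_exp_p (Δ : ℝ) : conj (exp ((2 - Δ) * I / 4)) = exp (-((2 - Δ) * I / 4)) := by
  rw [← Complex.exp_conj]; congr 1
  simp [Complex.conj_ofNat]; ring

lemma conj_exp_q (Δ : ℝ) : conj (exp (Δ * I / 4)) = exp (-(Δ * I / 4)) := by
  rw [← Complex.exp_conj]; congr 1
  simp [Complex.conj_ofNat]; ring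

lemma conj_τ (Δ : ℝ) :
    conj (τ Δ) = exp (-((2 - Δ) * I / 4)) - I * exp (-(Δ * I / 4)) := by
  rw [τ, map_add, map_mul, conj_exp_p, conj_exp_q, conj_I]; ring

lemma conj_a (Δ : ℝ) : conj (a Δ) = exp (-(Δ * I / 4)) - I * exp (-((2 - Δ) * I / 4))
    + I * exp (-(Δ * I / 4)) + ((2 - Δ) / 4) * conj (τ Δ) := by
  simp only [a, map_add, map_sub, map_mul, map_div₀, conj_exp_p, conj_exp_q, conj_I, conj_ofReal,
    Complex.conj_ofNat]
  ring

lemma conj_b (Δ : ℝ) : conj (b Δ) = exp (-(Δ * I / 4)) - I * exp (-((2 - Δ) * I / 4))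
    - exp (-((2 - Δ) * I / 4)) + ((2 - Δ) / 4) * conj (τ Δ) := by
  simp only [b, map_add, map_sub, map_mul, map_div₀, conj_exp_p, conj_exp_q, conj_I, conj_ofReal,
    Complex.conj_ofNat]
  ring

/-- A number minus its conjugate is purely imaginary. Once the four exponentials are treated as
letters with pp' = qq' = 1 and i² = -1, the identity is polynomial. -/
lemma den_eq (Δ : ℝ) : den Δ = 2 * I * ((2 - 2 * Real.sin ((1 - Δ) / 2)
    - Δ / 2 * Real.cos ((1 - Δ) / 2) : ℝ) : ℂ) := by
  have hp : exp ((2 - Δ) * I / 4) * exp (-((2 - Δ) * I / 4)) = 1 := by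
    rw [← Complex.exp_add]; simp
  have hq : exp (Δ * I / 4) * exp (-(Δ * I / 4)) = 1 := by
    rw [← Complex.exp_add]; simp
  have h1 : exp ((2 - Δ) * I / 4) * exp (-(Δ * I / 4)) = exp (((1 - Δ) / 2 : ℂ) * I) := by
    rw [← Complex.exp_add]; congr 1; ring
  have h2 : exp (-((2 - Δ) * I / 4)) * exp (Δ * I / 4) = exp (-((1 - Δ) / 2 : ℂ) * I) := by
    rw [← Complex.exp_add]; congr 1; ring
  push_cast
  rw [den, conj_a, conj_b, a, b, conj_τ, τ, Complex.sin, Complex.cos, ← h1, ← h2]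
  have hI := I_mul_I
  generalize exp ((2 - Δ) * I / 4) = p at *
  generalize exp (-((2 - Δ) * I / 4)) = p' at *
  generalize exp (Δ * I / 4) = q at *
  generalize exp (-(Δ * I / 4)) = q' at *
  clear h1 h2
  generalize (Δ : ℂ) = x at *
  generalize I = i at *
  grind

/-- For 1 < Δ ≤ 2 the sine is nonpositive and (Δ/2)cos ≤ 1, so the real factor is at least 1. -/
lemma den_ne_zero {Δ : ℝ} (h1 : 1 < Δ) (h2 : Δ ≤ 2) : den Δ ≠ 0 := by
  rw [den_eq]
  have hs : Real.sin ((1 - Δ) / 2) ≤ 0 :=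
    Real.sin_nonpos_of_nonpos_of_neg_pi_le (by linarith) (by linarith [Real.pi_gt_three])
  have hc := Real.cos_le_one ((1 - Δ) / 2)
  have hpos : 0 < 2 - 2 * Real.sin ((1 - Δ) / 2) - Δ / 2 * Real.cos ((1 - Δ) / 2) := by
    nlinarith
  have : ((2 - 2 * Real.sin ((1 - Δ) / 2) - Δ / 2 * Real.cos ((1 - Δ) / 2) : ℝ) : ℂ) ≠ 0 :=
    Complex.ofReal_ne_zero.2 hpos.ne'
  exact mul_ne_zero (mul_ne_zero two_ne_zero I_ne_zero) this

lemma conj_sinQuot (c : ℝ) (w : ℂ) : conj (sinQuot c w) = sinQuot c (conj w) := by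
  unfold sinQuot
  by_cases hw : w = 0
  · simp [hw]
  · have hw' : conj w ≠ 0 := by simpa using hw
    rw [if_neg hw, if_neg hw', map_div₀, ← Complex.sin_conj]
    simp

lemma conj_C (w : ℂ) : conj (C w) =
    (-16 * π ^ 2 * conj w ^ 2 + 4 * π * I * conj w * exp (-2 * π * I * conj w)) /
      (1 - 16 * π ^ 2 * conj w ^ 2) := by
  simp only [C, map_div₀, map_sub, map_mul, map_neg, map_pow, map_one, conj_ofReal, conj_I,
    Complex.conj_ofNat, ← Complex.exp_conj]
  rw [show 2 * (π : ℂ) * -I * conj w = -2 * π * I * conj w by ring]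
  ring

lemma conj_F (Δ : ℝ) (w : ℂ) : conj (F Δ w) = F Δ (conj w) := by
  simp only [F, map_div₀, map_sub, map_mul, map_pow, map_one, conj_ofReal, Complex.conj_ofNat,
    ← Complex.sin_conj, ← Complex.cos_conj]

lemma conj_G (Δ : ℝ) (w : ℂ) : conj (G Δ w) =
    (2 * cos (π * Δ * conj w) - 4 * π * I * conj w * exp (π * Δ * I * conj w)
        - exp (-π * (2 - Δ) * I * conj w)) / (1 - 16 * π ^ 2 * conj w ^ 2)
      - sinQuot (2 - Δ) (conj w) / (2 * (1 - 16 * π ^ 2 * conj w ^ 2))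
      + ((2 - Δ) / 4) * F Δ (conj w) := by
  simp only [G, map_add, map_div₀, map_sub, map_mul, map_neg, map_pow, map_one, conj_ofReal, conj_I,
    Complex.conj_ofNat, ← Complex.exp_conj, ← Complex.cos_conj, conj_sinQuot, conj_F]
  rw [show -(π : ℂ) * Δ * -I * conj w = π * Δ * I * conj w by ring,
    show (π : ℂ) * (2 - Δ) * -I * conj w = -π * (2 - Δ) * I * conj w by ring]
  ring

/-- `A` and `B` are Cramer's formulas for this 2×2 system; conjugation only changes the sign of
`den`. -/
lemma linear_A_B {Δ : ℝ} (hden : den Δ ≠ 0) (w : ℂ) :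
    conj (a Δ) * conj (A Δ w) + a Δ * conj (B Δ w) = conj (G Δ w) ∧
    conj (b Δ) * conj (A Δ w) + b Δ * conj (B Δ w) = G Δ (conj w) := by
  have hc : conj (den Δ) = -den Δ := by simp [den]
  have hA : conj (A Δ w) = (a Δ * G Δ (conj w) - b Δ * conj (G Δ w)) / -den Δ := by
    rw [A, map_div₀, hc]; simp
  have hB : conj (B Δ w) = (conj (b Δ) * conj (G Δ w) - conj (a Δ) * G Δ (conj w)) / -den Δ := by
    rw [B, map_div₀, hc]; simp
  rw [hA, hB]
  have hn : -den Δ ≠ 0 := neg_ne_zero.2 hden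
  constructor
  · rw [mul_div_assoc', mul_div_assoc', ← add_div, div_eq_iff hn]
    simp only [den]; ring
  · rw [mul_div_assoc', mul_div_assoc', ← add_div, div_eq_iff hn]
    simp only [den]; ring

/-- The junction conditions of `reproducesAt_kernelAux` in algebraic form. -/
lemma junction_algebra {p p' q q' m P P' Q Q' X S dd c c' τ' τ'' f g₁ g₂ α β δ : ℂ}
    (hP : P * P' = 1) (hQ : Q * Q' = 1) (hdd : dd = 1 + X ^ 2) (hdd0 : dd ≠ 0)
    (hS : X * S = 2 * (P - P')) (hc : c = (X ^ 2 - X * (P * Q)) / dd)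
    (hc' : c' = (X ^ 2 + X * (P' * Q')) / dd)
    (hf : f = (P + P' + X * (Q - Q')) / dd)
    (hg₁ : g₁ = (Q + Q' - X * Q - P') / dd - S / (2 * dd) + m * f)
    (hg₂ : g₂ = (Q + Q' + X * Q' - P) / dd - S / (2 * dd) + m * f)
    (hτ : τ' = p + I * q) (hτ' : τ'' = p' - I * q')
    (h1 : (q' - I * p' + I * q' + m * τ'') * α + (q + I * p - I * q + m * τ') * β = g₁)
    (h2 : (q' - I * p' - p' + m * τ'') * α + (q + I * p - p + m * τ') * β = g₂)
    (h3 : 2 * δ = τ'' * α + τ' * β - f) :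
    (-I * q' * α + I * q * β + c * P' - P' = δ) ∧ (p' * α + p * β + c' * P - P = δ) ∧
      (-I * p' * α + I * p * β + c * Q' - Q') + (q' * α + q * β + c' * Q - Q)
        + 1 / 2 * (δ * (4 * m) + S) = δ := by
  have kc : (c - 1) * dd = -(1 + X * (P * Q)) := by
    rw [hc, sub_mul, div_mul_cancel₀ _ hdd0, hdd]; ring
  have kc' : (c' - 1) * dd = -(1 - X * (P' * Q')) := by
    rw [hc', sub_mul, div_mul_cancel₀ _ hdd0, hdd]; ring
  -- Rewritten through c - 1 and c' - 1, the right-hand sides become boundary values of the forcing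
  -- terms. Then `h3` is the sum of the first two junction conditions, h1 - h2 is their difference,
  -- and the third follows from `h1`, `h3` and the first.
  have kf : f = -((c - 1) * P' + (c' - 1) * P) := by
    refine mul_right_cancel₀ hdd0 ?_
    have : f * dd = P + P' + X * (Q - Q') := by rw [hf, div_mul_cancel₀ _ hdd0]
    linear_combination this + P' * kc + P * kc' + (X * Q' - X * Q) * hP
  have k₁ : g₁ = -(c - 1) * Q' - (c' - 1) * Q - S / 2 + m * f + (c - 1) * P' := by
    refine mul_right_cancel₀ hdd0 ?_
    have : g₁ * dd = (Q + Q' - X * Q - P') - S / 2 + m * f * dd := by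
      rw [hg₁]; field_simp
    rw [this]
    linear_combination Q' * kc + Q * kc' - P' * kc + X * (P' - P) * hQ + Q * X * hP + S / 2 * hdd
      + X / 2 * hS
  have k₂ : g₂ = -(c - 1) * Q' - (c' - 1) * Q - S / 2 + m * f + (c' - 1) * P := by
    refine mul_right_cancel₀ hdd0 ?_
    have : g₂ * dd = (Q + Q' + X * Q' - P) - S / 2 + m * f * dd := by
      rw [hg₂]; field_simp
    rw [this]
    linear_combination Q' * kc + Q * kc' - P * kc' + X * (P' - P) * hQ - Q' * X * hP + S / 2 * hdd
      + X / 2 * hS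
  subst hτ hτ'
  have e1 : -I * q' * α + I * q * β + c * P' - P' = δ := by
    linear_combination (-1 / 2 : ℂ) * h3 - (1 / 2 : ℂ) * (h1 - h2) + (1 / 2 : ℂ) * (k₂ - k₁)
      + (1 / 2 : ℂ) * kf
  have e2 : p' * α + p * β + c' * P - P = δ := by
    linear_combination (-1 / 2 : ℂ) * h3 + (1 / 2 : ℂ) * (h1 - h2) + (1 / 2 : ℂ) * (k₁ - k₂)
      + (1 / 2 : ℂ) * kf
  refine ⟨e1, e2, ?_⟩
  linear_combination h1 + k₁ + m * h3 + e1

lemma mul_sinQuot (c : ℝ) (u : ℂ) : π * u * sinQuot c u = sin (π * c * u) := by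
  unfold sinQuot
  by_cases hu : u = 0
  · simp [hu]
  · have hp : (π : ℂ) ≠ 0 := by exact_mod_cast Real.pi_ne_zero
    rw [if_neg hu, mul_div_cancel₀ _ (mul_ne_zero hp hu)]

lemma conj_one_sub_ne_zero {w : ℂ} (hw : 1 - 16 * π ^ 2 * w ^ 2 ≠ 0) :
    1 - 16 * (π : ℂ) ^ 2 * conj w ^ 2 ≠ 0 := by
  intro h
  apply hw
  have := congrArg conj h
  simpa [Complex.conj_ofNat] using this

/-- The kernel for `1 < Δ ≤ 2` as a function of both variables, regular in `z`. -/
def kernelMid (Δ : ℝ) (w z : ℂ) : ℂ :=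
  kernelAux (Δ / 2) (conj (A Δ w)) (conj (B Δ w)) (C (conj w)) (conj (C w)) (conj (D Δ w))
    (conj w) z

/-- With X = 4πiζ, the number 1 - 16π²ζ² = 1 + X² is the determinant of the system for c and c'. It
vanishes exactly when exp(-2πiζt) is one of e^{±it/2}, which `hw` excludes. -/
lemma reproducesAt_kernelMid {Δ : ℝ} (hΔ : 1 < Δ) (hΔ2 : Δ ≤ 2) {w : ℂ}
    (hw : 1 - 16 * π ^ 2 * w ^ 2 ≠ 0) : ReproducesAt Δ w (kernelMid Δ w) := by
  have hdd := conj_one_sub_ne_zero hw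
  have hden := den_ne_zero hΔ hΔ2
  obtain ⟨hAB1, hAB2⟩ := linear_A_B hden w
  have hD : 2 * conj (D Δ w) = conj (τ Δ) * conj (A Δ w) + τ Δ * conj (B Δ w) - F Δ (conj w) := by
    rw [D]
    simp only [map_mul, map_sub, map_add, map_div₀, map_one, Complex.conj_ofNat, conj_F, conj_conj]
    ring
  unfold kernelMid
  set ζ := conj w with hζ
  set α := conj (A Δ w)
  set β := conj (B Δ w)
  set δ := conj (D Δ w)
  set c := C ζ with hc
  set c' := conj (C w) with hc'
  have hE : exp (2 * π * I * ζ) * exp (-2 * π * I * ζ) = 1 := by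
    rw [← Complex.exp_add]; ring_nf; simp
  have hcv : c * (1 - 16 * π ^ 2 * ζ ^ 2) =
      -16 * π ^ 2 * ζ ^ 2 - 4 * π * I * ζ * exp (2 * π * I * ζ) := by
    rw [hc, C, div_mul_cancel₀ _ hdd]
  have hcv' : c' * (1 - 16 * π ^ 2 * ζ ^ 2) =
      -16 * π ^ 2 * ζ ^ 2 + 4 * π * I * ζ * exp (-2 * π * I * ζ) := by
    rw [hc', conj_C, div_mul_cancel₀ _ hdd]
  have hPQ : exp (π * I * (2 - Δ) * ζ) * exp (π * I * Δ * ζ) = exp (2 * π * I * ζ) := by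
    rw [← Complex.exp_add]; congr 1; ring
  have hPQ' : exp (-(π * I * (2 - Δ) * ζ)) * exp (-(π * I * Δ * ζ)) = exp (-2 * π * I * ζ) := by
    rw [← Complex.exp_add]; congr 1; ring
  have hX2 : (4 * π * I * ζ) ^ 2 = -16 * π ^ 2 * ζ ^ 2 := by
    linear_combination 16 * (π : ℂ) ^ 2 * ζ ^ 2 * I_sq
  obtain ⟨j1, j2, j3⟩ := junction_algebra
    (p := exp ((2 - Δ) * I / 4)) (p' := exp (-((2 - Δ) * I / 4)))
    (q := exp (Δ * I / 4)) (q' := exp (-(Δ * I / 4))) (m := (2 - Δ) / 4)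
    (P := exp (π * I * (2 - Δ) * ζ)) (P' := exp (-(π * I * (2 - Δ) * ζ)))
    (Q := exp (π * I * Δ * ζ)) (Q' := exp (-(π * I * Δ * ζ))) (X := 4 * π * I * ζ)
    (S := sinQuot (2 - Δ) ζ) (dd := 1 - 16 * π ^ 2 * ζ ^ 2) (c := c) (c' := c')
    (τ' := τ Δ) (τ'' := conj (τ Δ)) (f := F Δ ζ) (g₁ := conj (G Δ w)) (g₂ := G Δ ζ)
    (α := α) (β := β) (δ := δ)
    (by rw [← Complex.exp_add]; simp) (by rw [← Complex.exp_add]; simp)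
    (by rw [hX2]; ring) hdd
    (by
      have h1 := mul_sinQuot (2 - Δ) ζ
      rw [Complex.sin] at h1
      push_cast at h1
      rw [show (π : ℂ) * I * (2 - Δ) * ζ = π * (2 - Δ) * ζ * I by ring,
        ← neg_mul (π * (2 - Δ) * ζ : ℂ) I]
      linear_combination 4 * I * h1 + (2 * exp (-(π * (2 - Δ) * ζ : ℂ) * I)
        - 2 * exp ((π * (2 - Δ) * ζ : ℂ) * I)) * I_sq)
    (by rw [eq_div_iff hdd, hcv, hPQ, hX2]) (by rw [eq_div_iff hdd, hcv', hPQ', hX2])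
    (by
      rw [F, Complex.cos, Complex.sin]
      rw [show (π : ℂ) * I * (2 - Δ) * ζ = π * (2 - Δ) * ζ * I by ring,
        show (π : ℂ) * I * Δ * ζ = π * Δ * ζ * I by ring,
        ← neg_mul (π * (2 - Δ) * ζ : ℂ) I, ← neg_mul (π * Δ * ζ : ℂ) I]
      ring)
    (by
      rw [conj_G, Complex.cos]
      rw [show (π : ℂ) * I * (2 - Δ) * ζ = π * (2 - Δ) * ζ * I by ring,
        show (π : ℂ) * I * Δ * ζ = π * Δ * ζ * I by ring,
        ← neg_mul (π * Δ * ζ : ℂ) I, ← hζ,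
        show (π : ℂ) * Δ * I * ζ = π * Δ * ζ * I by ring,
        show -(π : ℂ) * (2 - Δ) * I * ζ = -(π * (2 - Δ) * ζ * I) by ring]
      ring)
    (by
      rw [G, Complex.cos]
      rw [show (π : ℂ) * I * (2 - Δ) * ζ = π * (2 - Δ) * ζ * I by ring,
        show (π : ℂ) * I * Δ * ζ = π * Δ * ζ * I by ring,
        ← neg_mul (π * Δ * ζ : ℂ) I,
        show -(π : ℂ) * Δ * I * ζ = -(π * Δ * ζ) * I by ring,
        show (π : ℂ) * (2 - Δ) * I * ζ = π * (2 - Δ) * ζ * I by ring]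
      ring)
    rfl (conj_τ Δ) (by rw [← hAB1, conj_a, a]) (by rw [← hAB2, conj_b, b]) hD
  have hmain := reproducesAt_kernelAux (L := Δ / 2) (by linarith) (by linarith) (α := α) (β := β)
    (c := c) (c' := c') (δ := δ) hζ ?_ ?_ ?_ ?_ ?_
  · rwa [show 2 * (Δ / 2) = Δ by ring] at hmain
  · refine mul_right_cancel₀ hdd ?_
    linear_combination hcv - 4 * π * I * ζ * exp (2 * π * I * ζ) * hcv'
      - (4 * π * I * ζ) ^ 2 * hE - hX2
  · refine mul_right_cancel₀ hdd ?_
    linear_combination hcv' + 4 * π * I * ζ * exp (-2 * π * I * ζ) * hcv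
      - (4 * π * I * ζ) ^ 2 * hE - hX2
  · rw [← j1, solRight]
    have e1 : exp (-(I / 2)) * exp (I / 2 * (1 - Δ / 2 : ℝ)) = exp (-(Δ * I / 4)) := by
      rw [← Complex.exp_add]; congr 1; push_cast; ring
    have e2 : exp (I / 2) * exp (-(I / 2) * (1 - Δ / 2 : ℝ)) = exp (Δ * I / 4) := by
      rw [← Complex.exp_add]; congr 1; push_cast; ring
    have e3 : exp (-2 * π * I * ζ * (1 - Δ / 2 : ℝ)) = exp (-(π * I * (2 - Δ) * ζ)) := by
      congr 1; push_cast; ring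
    rw [e3, ← e1, ← e2]; ring
  · rw [← j2, solLeft]
    have e1 : exp (I / 2 * (Δ / 2 - 1 : ℝ)) = exp (-((2 - Δ) * I / 4)) := by
      congr 1; push_cast; ring
    have e2 : exp (-(I / 2) * (Δ / 2 - 1 : ℝ)) = exp ((2 - Δ) * I / 4) := by
      congr 1; push_cast; ring
    have e3 : exp (-2 * π * I * ζ * (Δ / 2 - 1 : ℝ)) = exp (π * I * (2 - Δ) * ζ) := by
      congr 1; push_cast; ring
    rw [e1, e2, e3]; ring
  · rw [show 2 - 2 * (Δ / 2) = 2 - Δ by ring]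
    refine Eq.trans ?_ j3
    rw [solRight, solLeft]
    have e1 : exp (-(I / 2)) * exp (I / 2 * (Δ / 2 : ℝ)) = exp (-((2 - Δ) * I / 4)) := by
      rw [← Complex.exp_add]; congr 1; push_cast; ring
    have e2 : exp (I / 2) * exp (-(I / 2) * (Δ / 2 : ℝ)) = exp ((2 - Δ) * I / 4) := by
      rw [← Complex.exp_add]; congr 1; push_cast; ring
    have e3 : exp (-2 * π * I * ζ * (Δ / 2 : ℝ)) = exp (-(π * I * Δ * ζ)) := by
      congr 1; push_cast; ring
    have e4 : exp (-2 * π * I * ζ * (-(Δ / 2) : ℝ)) = exp (π * I * Δ * ζ) := by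
      congr 1; push_cast; ring
    have e5 : exp (I / 2 * (-(Δ / 2) : ℝ)) = exp (-(Δ * I / 4)) := by
      congr 1; push_cast; ring
    have e6 : exp (-(I / 2) * (-(Δ / 2) : ℝ)) = exp (Δ * I / 4) := by
      congr 1; push_cast; ring
    rw [e3, e4, e5, e6, ← e1, ← e2]
    push_cast
    ring

/-! ### The closed form -/

lemma kernelMid_eq_kernelLarge (Δ : ℝ) {w z : ℂ} (h : (w, z) ∈ regular) :
    kernelMid Δ w z = kernelLarge Δ w z := by
  obtain ⟨-, h1, h2, h3⟩ := h
  simp only at h1 h2 h3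
  have h4 : 2 * π * I * (z - conj w) ≠ 0 := by
    have : z - conj w ≠ 0 := sub_ne_zero.2 h3
    simp [this, Real.pi_ne_zero]
  have h2' : 2 * π * I * z + -(I / 2) ≠ 0 := by rwa [← sub_eq_add_neg]
  rw [kernelMid, kernelAux, kernelLarge, sinQuot_eq_expInt, sinQuot_eq_expInt]
  have e1 : 2 * π * I * z + -2 * π * I * conj w = 2 * π * I * (z - conj w) := by ring
  rw [e1, add_zero, show -((2 - Δ) / 2) = Δ / 2 - 1 by ring, show (2 - Δ) / 2 = 1 - Δ / 2 by ring]
  -- The right interval is the left one translated by 1, so the two integrals differ by the factor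
  -- exp(2πiz + i/2). This yields the common factor i·e^{2πiz} - 1; the `B` term is analogous.
  have tA : conj (A Δ w) * expInt (-(Δ / 2)) (Δ / 2 - 1) (2 * π * I * z + I / 2)
      + -I * exp (-(I / 2)) * conj (A Δ w) * expInt (1 - Δ / 2) (Δ / 2) (2 * π * I * z + I / 2)
      = conj (A Δ w) * (I * exp (2 * π * I * z) - 1) *
      (exp (-Δ * (π * I * z + I / 4)) - exp (-(2 - Δ) * (π * I * z + I / 4)))
      / (2 * π * I * z + I / 2) := by
    rw [eq_div_iff h1]
    have m1 := mul_expInt (-(Δ / 2)) (Δ / 2 - 1) (2 * π * I * z + I / 2)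
    have m2 := mul_expInt (1 - Δ / 2) (Δ / 2) (2 * π * I * z + I / 2)
    have k1 : exp ((2 * π * I * z + I / 2) * (Δ / 2 - 1 : ℝ))
        = exp (-(2 - Δ) * (π * I * z + I / 4)) := by
      congr 1; push_cast; ring
    have k2 : exp ((2 * π * I * z + I / 2) * (-(Δ / 2) : ℝ))
        = exp (-Δ * (π * I * z + I / 4)) := by
      congr 1; push_cast; ring
    have k3 : exp (-(I / 2)) * exp ((2 * π * I * z + I / 2) * (Δ / 2 : ℝ))
        = exp (2 * π * I * z) * exp (-(2 - Δ) * (π * I * z + I / 4)) := by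
      rw [← Complex.exp_add, ← Complex.exp_add]; congr 1; push_cast; ring
    have k4 : exp (-(I / 2)) * exp ((2 * π * I * z + I / 2) * (1 - Δ / 2 : ℝ))
        = exp (2 * π * I * z) * exp (-Δ * (π * I * z + I / 4)) := by
      rw [← Complex.exp_add, ← Complex.exp_add]; congr 1; push_cast; ring
    rw [k1, k2] at m1
    linear_combination conj (A Δ w) * m1 - I * exp (-(I / 2)) * conj (A Δ w) * m2
      - I * conj (A Δ w) * (k3 - k4)
  have tB : conj (B Δ w) * expInt (-(Δ / 2)) (Δ / 2 - 1) (2 * π * I * z + -(I / 2))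
      + I * exp (I / 2) * conj (B Δ w) * expInt (1 - Δ / 2) (Δ / 2) (2 * π * I * z + -(I / 2))
      = conj (B Δ w) * (-I * exp (2 * π * I * z) - 1) *
      (exp (-Δ * (π * I * z - I / 4)) - exp (-(2 - Δ) * (π * I * z - I / 4)))
      / (2 * π * I * z - I / 2) := by
    rw [sub_eq_add_neg (2 * π * I * z) (I / 2), eq_div_iff h2']
    have m1 := mul_expInt (-(Δ / 2)) (Δ / 2 - 1) (2 * π * I * z + -(I / 2))
    have m2 := mul_expInt (1 - Δ / 2) (Δ / 2) (2 * π * I * z + -(I / 2))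
    have k1 : exp ((2 * π * I * z + -(I / 2)) * (Δ / 2 - 1 : ℝ))
        = exp (-(2 - Δ) * (π * I * z - I / 4)) := by
      congr 1; push_cast; ring
    have k2 : exp ((2 * π * I * z + -(I / 2)) * (-(Δ / 2) : ℝ))
        = exp (-Δ * (π * I * z - I / 4)) := by
      congr 1; push_cast; ring
    have k3 : exp (I / 2) * exp ((2 * π * I * z + -(I / 2)) * (Δ / 2 : ℝ))
        = exp (2 * π * I * z) * exp (-(2 - Δ) * (π * I * z - I / 4)) := by
      rw [← Complex.exp_add, ← Complex.exp_add]; congr 1; push_cast; ring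
    have k4 : exp (I / 2) * exp ((2 * π * I * z + -(I / 2)) * (1 - Δ / 2 : ℝ))
        = exp (2 * π * I * z) * exp (-Δ * (π * I * z - I / 4)) := by
      rw [← Complex.exp_add, ← Complex.exp_add]; congr 1; push_cast; ring
    rw [k1, k2] at m1
    linear_combination conj (B Δ w) * m1 + I * exp (I / 2) * conj (B Δ w) * m2
      + I * conj (B Δ w) * (k3 - k4)
  have tC : conj (C w) * expInt (-(Δ / 2)) (Δ / 2 - 1) (2 * π * I * (z - conj w))
      + C (conj w) * expInt (1 - Δ / 2) (Δ / 2) (2 * π * I * (z - conj w))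
      = (C (conj w) * (exp (π * Δ * I * (z - conj w)) - exp (π * (2 - Δ) * I * (z - conj w)))
        + conj (C w) * (-exp (-π * Δ * I * (z - conj w)) + exp (-π * (2 - Δ) * I * (z - conj w))))
      / (2 * π * I * (z - conj w)) := by
    rw [eq_div_iff h4]
    have m1 := mul_expInt (-(Δ / 2)) (Δ / 2 - 1) (2 * π * I * (z - conj w))
    have m2 := mul_expInt (1 - Δ / 2) (Δ / 2) (2 * π * I * (z - conj w))
    have k1 : exp (2 * π * I * (z - conj w) * (Δ / 2 - 1 : ℝ))
        = exp (-π * (2 - Δ) * I * (z - conj w)) := by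
      congr 1; push_cast; ring
    have k2 : exp (2 * π * I * (z - conj w) * (-(Δ / 2) : ℝ))
        = exp (-π * Δ * I * (z - conj w)) := by
      congr 1; push_cast; ring
    have k3 : exp (2 * π * I * (z - conj w) * (Δ / 2 : ℝ))
        = exp (π * Δ * I * (z - conj w)) := by
      congr 1; push_cast; ring
    have k4 : exp (2 * π * I * (z - conj w) * (1 - Δ / 2 : ℝ))
        = exp (π * (2 - Δ) * I * (z - conj w)) := by
      congr 1; push_cast; ring
    rw [k1, k2] at m1
    rw [k3, k4] at m2
    linear_combination conj (C w) * m1 + C (conj w) * m2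
  linear_combination tA + tB + tC

/-! ### Existence at the resonant points by averaging over circles -/

/-- The points `w` at which `kernelMid Δ w` is the kernel. -/
def nonresonant : Set ℂ := {w | 1 - 16 * (π : ℂ) ^ 2 * w ^ 2 ≠ 0}

lemma continuous_sinQuot (c : ℝ) : Continuous (sinQuot c) := by
  have : sinQuot c = fun u => expInt (-(c / 2)) (c / 2) (2 * π * I * u) :=
    funext (sinQuot_eq_expInt c)
  rw [this]
  exact (continuous_expInt _ _).comp (by fun_prop)

lemma mapsTo_conj_nonresonant : Set.MapsTo (fun w => conj w) nonresonant nonresonant :=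
  fun _ hw => conj_one_sub_ne_zero hw

lemma continuousOn_conj_comp {f : ℂ → ℂ} (hf : ContinuousOn f nonresonant) :
    ContinuousOn (fun w => f (conj w)) nonresonant :=
  hf.comp Complex.continuous_conj.continuousOn mapsTo_conj_nonresonant

lemma ContinuousOn.conj_apply {s : Set ℂ} {f : ℂ → ℂ} (hf : ContinuousOn f s) :
    ContinuousOn (fun w => conj (f w)) s := Complex.continuous_conj.comp_continuousOn hf

lemma continuousOn_C : ContinuousOn C nonresonant := by
  unfold C
  exact ContinuousOn.div (by fun_prop) (by fun_prop) fun w hw => hw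

lemma continuousOn_F (Δ : ℝ) : ContinuousOn (F Δ) nonresonant := by
  unfold F
  exact ContinuousOn.div (by fun_prop) (by fun_prop) fun w hw => hw

lemma continuousOn_G (Δ : ℝ) : ContinuousOn (G Δ) nonresonant := by
  have h1 := continuousOn_F Δ
  have h2 := (continuous_sinQuot (2 - Δ)).continuousOn (s := nonresonant)
  unfold G
  refine ((ContinuousOn.div (by fun_prop) (by fun_prop) fun w hw => hw).sub
    (h2.div (by fun_prop) fun w hw => mul_ne_zero two_ne_zero hw)).add (by fun_prop)

lemma continuousOn_A (Δ : ℝ) : ContinuousOn (A Δ) nonresonant := by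
  have h1 := continuousOn_G Δ
  have h2 := ContinuousOn.conj_apply (continuousOn_conj_comp h1)
  unfold A
  fun_prop

lemma continuousOn_B (Δ : ℝ) : ContinuousOn (B Δ) nonresonant := by
  have h1 := continuousOn_G Δ
  have h2 := ContinuousOn.conj_apply (continuousOn_conj_comp h1)
  unfold B
  fun_prop

lemma continuousOn_D (Δ : ℝ) : ContinuousOn (D Δ) nonresonant := by
  have h1 := continuousOn_A Δ
  have h2 := continuousOn_B Δ
  have h3 := continuousOn_F Δ
  unfold D
  fun_prop

lemma continuousOn_kernelMid (Δ : ℝ) :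
    ContinuousOn (fun p : ℂ × ℂ => kernelMid Δ p.1 p.2) (nonresonant ×ˢ Set.univ) := by
  have hfst : ∀ {f : ℂ → ℂ}, ContinuousOn f nonresonant →
      ContinuousOn (fun p : ℂ × ℂ => f p.1) (nonresonant ×ˢ Set.univ) := fun hf =>
    hf.comp continuousOn_fst fun p hp => hp.1
  have hA := hfst (ContinuousOn.conj_apply (continuousOn_A Δ))
  have hB := hfst (ContinuousOn.conj_apply (continuousOn_B Δ))
  have hC := hfst (ContinuousOn.conj_apply continuousOn_C)
  have hC' := hfst (continuousOn_conj_comp continuousOn_C)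
  have hD := hfst (ContinuousOn.conj_apply (continuousOn_D Δ))
  have hE : ∀ α β, Continuous (expInt α β) := continuous_expInt
  have hconj := Complex.continuous_conj
  unfold kernelMid kernelAux
  fun_prop

/-- A bound for the decay constant of `kernelMid Δ w`. -/
def boundMid (Δ : ℝ) (w : ℂ) : ℝ :=
  boundAux (Δ / 2) (conj (A Δ w)) (conj (B Δ w)) (C (conj w)) (conj (C w)) (conj (D Δ w)) (conj w)

lemma continuousOn_boundMid (Δ : ℝ) : ContinuousOn (boundMid Δ) nonresonant := by
  have hA := ContinuousOn.conj_apply (continuousOn_A Δ)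
  have hB := ContinuousOn.conj_apply (continuousOn_B Δ)
  have hC := ContinuousOn.conj_apply continuousOn_C
  have hC' := continuousOn_conj_comp continuousOn_C
  have hD := ContinuousOn.conj_apply (continuousOn_D Δ)
  have hconj := Complex.continuous_conj
  unfold boundMid boundAux
  fun_prop

lemma hasDecay_kernelMid {Δ : ℝ} (hΔ : 1 < Δ) (hΔ2 : Δ ≤ 2) (w : ℂ) :
    HasDecay (Δ / 2) (boundMid Δ w) (kernelMid Δ w) :=
  (isTransform_kernelAux (by linarith) (by linarith) _ _ _ _ _ _).hasDecay

lemma differentiable_kernelMid {Δ : ℝ} (hΔ : 1 < Δ) (hΔ2 : Δ ≤ 2) (w : ℂ) :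
    Differentiable ℂ (kernelMid Δ w) :=
  (isTransform_kernelAux (by linarith) (by linarith) _ _ _ _ _ _).differentiable

lemma exists_circle_nonresonant (w₀ : ℂ) :
    ∃ r : ℝ, 0 < r ∧ Metric.sphere w₀ r ⊆ nonresonant := by
  have hfin : ({‖1 / (4 * π : ℂ) - w₀‖, ‖-1 / (4 * π : ℂ) - w₀‖} : Set ℝ).Finite :=
    Set.toFinite _
  -- Only two radii give circles through ±1/(4π), so some radius in (0, 1) avoids both.
  obtain ⟨r, ⟨hr0, -⟩, hr⟩ := ((Set.Ioo_infinite (zero_lt_one' ℝ)).sdiff hfin).nonempty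
  refine ⟨r, hr0, fun w hw h => hr ?_⟩
  rw [mem_sphere_iff_norm] at hw
  have h2 : (4 * π * w - 1) * (4 * π * w + 1) = 0 := by linear_combination -h
  rcases mul_eq_zero.1 h2 with h3 | h3
  · left
    rw [← hw]; congr 2
    rw [eq_div_iff (by simp)]
    linear_combination h3
  · right
    rw [Set.mem_singleton_iff, ← hw]; congr 2
    rw [eq_div_iff (by simp)]
    linear_combination h3

lemma continuous_kernelMid_circleMap (Δ : ℝ) {w₀ : ℂ} {r : ℝ} (hr : 0 < r)
    (hs : Metric.sphere w₀ r ⊆ nonresonant) :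
    Continuous fun p : ℂ × ℝ => kernelMid Δ (circleMap w₀ r p.2) p.1 := by
  refine (continuousOn_kernelMid Δ).comp_continuous
    (f := fun p : ℂ × ℝ => (circleMap w₀ r p.2, p.1)) ?_ fun p =>
    ⟨hs (circleMap_mem_sphere w₀ hr.le p.2), Set.mem_univ _⟩
  exact ((continuous_circleMap w₀ r).comp continuous_snd).prodMk continuous_fst

/-- The explicit decay constant is continuous off resonance, hence bounded on the compact circle.
Its uniformity lets the average inherit the decay and justifies Fubini. -/
lemma exists_bound_circle (Δ : ℝ) {w₀ : ℂ} {r : ℝ} (hs : Metric.sphere w₀ r ⊆ nonresonant) :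
    ∃ N, ∀ w ∈ Metric.sphere w₀ r, boundMid Δ w ≤ N := by
  obtain ⟨N, hN⟩ := (isCompact_sphere w₀ r).exists_bound_of_continuousOn
    ((continuousOn_boundMid Δ).mono hs)
  exact ⟨N, fun w hw => (le_abs_self _).trans (hN w hw)⟩

/-- Averages of kernels over a circle reproduce at its centre. -/
lemma exists_reproducesAt {Δ : ℝ} (hΔ : 1 < Δ) (hΔ2 : Δ ≤ 2) (w₀ : ℂ) :
    ∃ k, ReproducesAt Δ w₀ k := by
  obtain ⟨r, hr, hs⟩ := exists_circle_nonresonant w₀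
  obtain ⟨N, hN⟩ := exists_bound_circle Δ hs
  have hmem : ∀ θ, circleMap w₀ r θ ∈ Metric.sphere w₀ r := circleMap_mem_sphere w₀ hr.le
  have hdec : ∀ θ, HasDecay (Δ / 2) N (kernelMid Δ (circleMap w₀ r θ)) := fun θ =>
    (hasDecay_kernelMid hΔ hΔ2 _).mono (hN _ (hmem θ))
  have hcont := continuous_kernelMid_circleMap Δ hr hs
  have h2π : (0 : ℝ) ≤ 2 * π := by positivity
  obtain ⟨k, hk⟩ : ∃ k : ℂ → ℂ, k = fun z =>
    (2 * π)⁻¹ • ∫ θ in 0..2 * π, kernelMid Δ (circleMap w₀ r θ) z := ⟨_, rfl⟩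
  have hkd : Differentiable ℂ k := by
    have := differentiable_intervalIntegral
      (g := fun z θ => kernelMid Δ (circleMap w₀ r θ) z) hcont
      (fun θ => differentiable_kernelMid hΔ hΔ2 _) 0 (2 * π)
    rw [hk]
    exact this.const_smul ((2 * π)⁻¹ : ℝ)
  have havg : ∀ (z : ℂ) (B : ℝ), (∀ θ, ‖kernelMid Δ (circleMap w₀ r θ) z‖ ≤ B) → ‖k z‖ ≤ B := by
    intro z B hB
    rw [hk, norm_smul, Real.norm_of_nonneg (by positivity), inv_mul_le_iff₀ (by positivity)]
    refine (intervalIntegral.norm_integral_le_of_norm_le_const fun θ _ => hB θ).trans_eq ?_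
    rw [sub_zero, abs_of_nonneg h2π, mul_comm]
  have hkdec : HasDecay (Δ / 2) N k := by
    refine ⟨fun z => havg z _ fun θ => (hdec θ).growth z, fun x => ?_⟩
    rw [← le_div_iff₀ (by positivity)]
    refine havg x _ fun θ => ?_
    rw [le_div_iff₀ (by positivity)]
    exact (hdec θ).decay x
  refine ⟨k, ?_, fun f hf => ?_⟩
  · have := hkdec.mem_space (by linarith) hkd
    rwa [show 2 * (Δ / 2) = Δ by ring] at this
  obtain ⟨f1, -, f3⟩ := (mem_space_iff (by linarith)).1 hf
  have hfc := f1.continuous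
  have hWc := continuous_W
  have hconj := Complex.continuous_conj
  have hcont' : Continuous fun p : ℝ × ℝ => kernelMid Δ (circleMap w₀ r p.2) (p.1 : ℂ) :=
    Continuous.comp (g := fun p : ℂ × ℝ => kernelMid Δ (circleMap w₀ r p.2) p.1)
      (f := fun p : ℝ × ℝ => ((p.1 : ℂ), p.2)) hcont
      ((continuous_ofReal.comp continuous_fst).prodMk continuous_snd)
  have hN0 : 0 ≤ N := le_trans (mul_nonneg (norm_nonneg _) (by positivity)) (hkdec.decay 0)
  have hint : Integrable (fun p : ℝ × ℝ =>
      f p.1 * conj (kernelMid Δ (circleMap w₀ r p.2) (p.1 : ℂ)) * (W p.1 : ℂ))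
      (volume.prod (volume.restrict (Set.Ioc 0 (2 * π)))) := by
    have h1 : Integrable (fun p : ℝ × ℝ => ‖f p.1‖ / (1 + |p.1|) * (2 * N))
        (volume.prod (volume.restrict (Set.Ioc 0 (2 * π)))) :=
      Integrable.mul_prod (f := fun x : ℝ => ‖f x‖ / (1 + |x|))
        (integrable_div_one_add_abs hfc f3) (integrable_const (2 * N))
    refine h1.mono' (Continuous.aestronglyMeasurable (by fun_prop)) (ae_of_all _ fun p => ?_)
    rw [norm_mul, norm_mul, RCLike.norm_conj, Complex.norm_real, Real.norm_of_nonneg (W_pos _).le]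
    have h2 : ‖kernelMid Δ (circleMap w₀ r p.2) (p.1 : ℂ)‖ ≤ N / (1 + |p.1|) := by
      rw [le_div_iff₀ (by positivity)]
      exact (hdec p.2).decay p.1
    have h3 := W_le_two p.1
    have h4 := (W_pos p.1).le
    calc _ ≤ ‖f p.1‖ * (N / (1 + |p.1|)) * 2 := by gcongr
      _ = _ := by ring
  -- Mean value property: on the circle `f` is reproduced by `kernelMid`, and interchanging the
  -- integrals puts the average on the kernel.
  have hmean : f w₀ = Real.circleAverage f w₀ r := (f1.diffContOnCl.circleAverage).symm
  have hrep : ∀ θ, f (circleMap w₀ r θ) = innerW f (kernelMid Δ (circleMap w₀ r θ)) := fun θ =>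
    (reproducesAt_kernelMid hΔ hΔ2 (hs (hmem θ))).2 f hf
  rw [hmean, Real.circleAverage_def]
  simp only [hrep, innerW, hk]
  rw [intervalIntegral.integral_of_le h2π, ← integral_integral_swap
    (f := fun (x : ℝ) (θ : ℝ) => f x * conj (kernelMid Δ (circleMap w₀ r θ) (x : ℂ)) * (W x : ℂ))
    hint, ← integral_smul]
  congr 1; ext x
  rw [intervalIntegral.integral_of_le h2π, Complex.real_smul, Complex.real_smul, map_mul,
    conj_ofReal, ← integral_conj, integral_mul_const, integral_const_mul]
  ring

/-! ### Hermitian symmetry, holomorphy in w̄ and joint continuity -/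

lemma innerW_conj_symm (f g : ℂ → ℂ) : conj (innerW f g) = innerW g f := by
  unfold innerW
  rw [← integral_conj]
  congr 1; ext x
  simp only [map_mul, conj_conj, conj_ofReal]
  ring

/-- Reproducing K(z, ·) at w gives K(z, w) = ⟨K(z, ·), K(w, ·)⟩, and the inner product is Hermitian.
-/
lemma IsReproducingKernel.conj_symm {Δ : ℝ} {K : ℂ → ℂ → ℂ} (hK : IsReproducingKernel Δ K)
    (w z : ℂ) : conj (K z w) = K w z := by
  rw [(hK w).2 _ (hK z).1, innerW_conj_symm, ← (hK z).2 _ (hK w).1]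

lemma IsReproducingKernel.differentiable_conj {Δ : ℝ} {K : ℂ → ℂ → ℂ}
    (hK : IsReproducingKernel Δ K) (z : ℂ) : Differentiable ℂ fun w => K (conj w) z := by
  have h1 : (fun w => K (conj w) z) = conj ∘ K z ∘ conj := by
    ext w
    simp [hK.conj_symm]
  rw [h1]
  have h2 : Differentiable ℂ (K z) := (hK z).1.1
  intro w
  exact differentiableAt_conj_conj_iff.2 (h2 _)

lemma IsReproducingKernel.continuous_left {Δ : ℝ} {K : ℂ → ℂ → ℂ}
    (hK : IsReproducingKernel Δ K) (z : ℂ) : Continuous fun w => K w z := by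
  have := (hK.differentiable_conj z).continuous.comp Complex.continuous_conj
  simpa [Function.comp_def] using this

lemma IsReproducingKernel.eq_of_reproducesAt {Δ : ℝ} (hΔ : 0 < Δ) {K : ℂ → ℂ → ℂ}
    (hK : IsReproducingKernel Δ K) {w : ℂ} {k : ℂ → ℂ} (hk : ReproducesAt Δ w k) : K w = k :=
  reproducing_unique hΔ (hK w).1 hk.1 (hK w).2 hk.2

/-- Separate continuity becomes joint once K(w, ·) is Lipschitz near `z₀` uniformly in w. On a
nonresonant circle about `w₀` K is the explicit kernel and bounded; the maximum principle in w̄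
extends the bound to the disc, and Cauchy's estimate in z turns it into a Lipschitz constant. -/
lemma IsReproducingKernel.tendsto_nhds {Δ : ℝ} (hΔ : 1 < Δ) (hΔ2 : Δ ≤ 2) {K : ℂ → ℂ → ℂ}
    (hK : IsReproducingKernel Δ K) (w₀ z₀ : ℂ) :
    Tendsto (fun p : ℂ × ℂ => K p.1 p.2) (𝓝 (w₀, z₀)) (𝓝 (K w₀ z₀)) := by
  obtain ⟨r, hr, hs⟩ := exists_circle_nonresonant w₀
  obtain ⟨M, hM⟩ := ((isCompact_sphere w₀ r).prod
    (isCompact_closedBall z₀ 2)).exists_bound_of_continuousOn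
    ((continuousOn_kernelMid Δ).mono (Set.prod_mono hs (Set.subset_univ _)))
  have hMs : ∀ w ∈ Metric.sphere w₀ r, ∀ z ∈ Metric.closedBall z₀ 2, ‖K w z‖ ≤ M := by
    intro w hw z hz
    rw [hK.eq_of_reproducesAt (by linarith) (reproducesAt_kernelMid hΔ hΔ2 (hs hw))]
    exact hM (w, z) ⟨hw, hz⟩
  have hMb : ∀ w ∈ Metric.ball w₀ r, ∀ z ∈ Metric.closedBall z₀ 2, ‖K w z‖ ≤ M := by
    intro w hw z hz
    have h1 := Complex.norm_le_of_forall_mem_frontier_norm_le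
      (f := fun u => K (conj u) z) (U := Metric.ball (conj w₀) r) (C := M) Metric.isBounded_ball
      (hK.differentiable_conj z).diffContOnCl (fun u hu => ?_) (z := conj w) (subset_closure ?_)
    · simpa using h1
    · rw [frontier_ball _ hr.ne'] at hu
      refine hMs _ ?_ z hz
      rw [mem_sphere_iff_norm] at hu ⊢
      rw [← hu, ← RCLike.norm_conj (u - conj w₀)]
      simp
    · rw [mem_ball_iff_norm] at hw ⊢
      rwa [← map_sub, RCLike.norm_conj]
  have hLip : ∀ w ∈ Metric.ball w₀ r, ∀ z ∈ Metric.ball z₀ 1,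
      ‖K w z - K w z₀‖ ≤ M * ‖z - z₀‖ := by
    intro w hw z hz
    have hd : Differentiable ℂ (K w) := (hK w).1.1
    refine (convex_ball z₀ 1).norm_image_sub_le_of_norm_deriv_le (fun y _ => hd y)
      (fun y hy => ?_) (Metric.mem_ball_self one_pos) hz
    have h2 := Complex.norm_deriv_le_of_forall_mem_sphere_norm_le (c := y) one_pos
      hd.diffContOnCl (C := M) fun x hx => hMb w hw x ?_
    · simpa using h2
    · rw [Metric.mem_closedBall]
      rw [Metric.mem_sphere] at hx
      rw [Metric.mem_ball] at hy
      linarith [dist_triangle x y z₀]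
  rw [tendsto_iff_norm_sub_tendsto_zero]
  refine squeeze_zero' (g := fun p : ℂ × ℂ => M * ‖p.2 - z₀‖ + ‖K p.1 z₀ - K w₀ z₀‖)
    (Eventually.of_forall fun p => norm_nonneg _) ?_ ?_
  · filter_upwards [prod_mem_nhds (Metric.ball_mem_nhds w₀ hr) (Metric.ball_mem_nhds z₀ one_pos)]
      with p hp
    have e : K p.1 p.2 - K w₀ z₀ = (K p.1 p.2 - K p.1 z₀) + (K p.1 z₀ - K w₀ z₀) := by ring
    rw [e]
    exact (norm_add_le _ _).trans (by gcongr; exact hLip _ hp.1 _ hp.2)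
  · have hc : Continuous fun p : ℂ × ℂ => M * ‖p.2 - z₀‖ + ‖K p.1 z₀ - K w₀ z₀‖ := by
      have := hK.continuous_left z₀
      fun_prop
    simpa using hc.tendsto (w₀, z₀)

lemma exists_isReproducingKernel {Δ : ℝ} (h0 : 0 < Δ) (h2 : Δ ≤ 2) :
    ∃ K, IsReproducingKernel Δ K := by
  have h : ∀ w, ∃ k, ReproducesAt Δ w k := by
    intro w
    rcases le_or_gt Δ 1 with h1 | h1
    · have := reproducesAt_kernelSmall (L := Δ / 2) (by linarith) (by linarith) w
      rw [show 2 * (Δ / 2) = Δ by ring] at this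
      exact ⟨_, this⟩
    · exact exists_reproducesAt h1 h2 w
  choose K hK using h
  exact ⟨K, hK⟩

end SOEven

end

open SOEven in
theorem theorem5 (Δ : ℝ) (hΔ : 0 < Δ) (hΔ' : Δ ≤ 2) :
    (∃! K : ℂ → ℂ → ℂ, IsReproducingKernel Δ K) ∧
    ∀ K : ℂ → ℂ → ℂ, IsReproducingKernel Δ K →
      (Δ ≤ 1 → ∀ w z : ℂ, K w z = kernelSmall Δ w z) ∧
      (1 < Δ →
        den Δ ≠ 0 ∧
        (∀ w z : ℂ, (w, z) ∈ regular → K w z = kernelLarge Δ w z) ∧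
        (∀ z : ℂ, Differentiable ℂ (fun w : ℂ => K (conj w) z)) ∧
        (∀ w₀ z₀ : ℂ, Tendsto (fun p : ℂ × ℂ => kernelLarge Δ p.1 p.2)
          (𝓝[regular] (w₀, z₀)) (𝓝 (K w₀ z₀)))) := by
  constructor
  · obtain ⟨K, hK⟩ := exists_isReproducingKernel hΔ hΔ'
    exact ⟨K, hK, fun K' hK' => funext fun w => hK'.eq_of_reproducesAt hΔ (hK w)⟩
  intro K hK
  refine ⟨fun h1 w z => ?_, fun h1 => ?_⟩
  · have := reproducesAt_kernelSmall (L := Δ / 2) (by linarith) (by linarith) w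
    rw [show 2 * (Δ / 2) = Δ by ring] at this
    rw [hK.eq_of_reproducesAt hΔ this]
  · have hreg : ∀ w z : ℂ, (w, z) ∈ regular → K w z = kernelLarge Δ w z := fun w z h => by
      rw [hK.eq_of_reproducesAt hΔ (reproducesAt_kernelMid h1 hΔ' h.1),
        kernelMid_eq_kernelLarge Δ h]
    refine ⟨den_ne_zero h1 hΔ', hreg, hK.differentiable_conj, fun w₀ z₀ => ?_⟩
    refine ((hK.tendsto_nhds h1 hΔ' w₀ z₀).mono_left nhdsWithin_le_nhds).congr' ?_
    filter_upwards [self_mem_nhdsWithin] with p hp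
    exact hreg p.1 p.2 hp
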